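/- Let $f_1,f_2:\mathbb{R}\times\mathbb{R}^N\to\mathbb{R}^N$, $(t,x)\mapsto f_i(t,x)$, be continuous and $C^2$ in $x$, with $D_xf_i$ and $D_x^2f_i$ continuous in $(t,x)$. Let $l_1:\mathbb{R}^N\to\mathbb{R}$ be $C^2$ and $m:\mathbb{R}^N\to\mathbb{R}$ twice differentiable. Let $t_0\le\tau<t_f$, and assume that on $[\tau,\tau+r]\times\mathbb{R}^N$, for some $r>0$, the difference $f_2-f_1$ has a partial derivative $\partial_t(f_2-f_1)$ that is continuous in $(t,x)$ (this derivative is $0$ if the modes do not depend explicitly on time). For $\lambda\ge0$ consider the switched system $$\dot x(t)=\begin{cases} f_1(t,x(t)), & t_0\le t<\tau,\\ f_2(t,x(t)), & \tau\le t<\tau+\lambda,\\ f_1(t,x(t)), & \tau+\lambda\le t\le t_f,\end{cases}\qquad x(t_0)=x_0,$$ and assume that the default trajectory $x$ (the case $\lambda=0$) exists on $[t_0,t_f]$. Then: 1. The backward linear differential equations $$\dot\rho=-D_xl_1(x(t))^T-D_xf_1(t,x(t))^T\rho,\qquad \rho(t_f)=D_xm(x(t_f))^T,$$ $$\dot\Omega=-D_xf_1(t,x(t))^T\,\Omega-\Omega\,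 D_xf_1(t,x(t))-D_x^2l_1(x(t))-\sum_{k=1}^N\rho_k\,D_x^2f_1^k(t,x(t)),\qquad \Omega(t_f)=D_x^2m(x(t_f))^T,$$ for the first-order adjoint $\rho$ and the second-order adjoint $\Omega$ along the default trajectory have solutions on $[t_0,t_f]$. 2. There is $\varepsilon>0$ with $\tau+\varepsilon\le t_f$ such that for every $\lambda\in[0,\varepsilon]$ the switched system has exactly one trajectory $x_\lambda$ on $[t_0,t_f]$, and the cost $J(\lambda)=\int_{t_0}^{t_f}l_1(x_\lambda(t))\,dt+m(x_\lambda(t_f))$ is twice differentiable on $[0,\varepsilon]$ (one-sidedly at the end points). For any such $\rho$ and $\Omega$, its second derivative at $0^+$ is $$\frac{d^2J}{d\lambda_+^2}=(f_2-f_1)^T\Omega(f_2-f_1)+\rho^T\big(D_xf_2\, f_2+D_xf_1\, f_1-2D_xf_1\, f_2\big)-D_xl_1\,(f_2-f_1)+\rho^T\,\partial_t(f_2-f_1),$$ where all functions are evaluated at the time $\tau$ and the state $x(\tau)$. In particular, if $\partial_t(f_2-f_1)$ vanishes at $(\tau,x(\tau))$, for instance if the modes do not depend explicitly on time, then $$\frac{d^2J}{d\lambda_+^2}=(f_2-f_1)^T\Omega(f_2-f_1)+\rho^T\big(D_xf_2\,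 f_2+D_xf_1\, f_1-2D_xf_1\, f_2\big)-D_xl_1\,(f_2-f_1).$$ If moreover $m$ is $C^2$, then $J''(\lambda)$ converges to $\frac{d^2J}{d\lambda_+^2}$ as $\lambda\to0^+$. -/

import Mathlib

open Set Filter Topology
open scoped Matrix

noncomputable section

/-- Jacobian matrix `D F (y)` of a vector field; entry `(i, j)` is `∂ F_i / ∂ y_j`. -/
def jacobianMatrix {N : ℕ} (F : (Fin N → ℝ) → (Fin N → ℝ)) (y : Fin N → ℝ) :
    Matrix (Fin N) (Fin N) ℝ :=
  Matrix.of fun i j => fderiv ℝ F y (Pi.single j 1) i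

/-- The vector of first partial derivatives of a scalar function. -/
def gradVec {N : ℕ} (φ : (Fin N → ℝ) → ℝ) (y : Fin N → ℝ) : Fin N → ℝ :=
  fun i => fderiv ℝ φ y (Pi.single i 1)

/-- The Hessian matrix of a scalar function; entry `(i, j)` is `∂² φ / ∂ y_i ∂ y_j`. -/
def hessianMatrix {N : ℕ} (φ : (Fin N → ℝ) → ℝ) (y : Fin N → ℝ) :
    Matrix (Fin N) (Fin N) ℝ :=
  Matrix.of fun i j =>
    fderiv ℝ (fun z => fderiv ℝ φ z (Pi.single j 1)) y (Pi.single i 1)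

/-- A (possibly time-dependent) mode `f t y` that is continuous in time and `C²` in the state:
`f`, `D_y f` and `D_y² f` exist and are continuous in `(t, y)`. -/
structure IsC2Mode {N : ℕ} (f : ℝ → (Fin N → ℝ) → (Fin N → ℝ)) : Prop where
  contDiff : ∀ t, ContDiff ℝ 2 (f t)
  continuous : Continuous fun p : ℝ × (Fin N → ℝ) => f p.1 p.2
  continuous_fderiv : Continuous fun p : ℝ × (Fin N → ℝ) => fderiv ℝ (f p.1) p.2
  continuous_fderiv2 :
    Continuous fun p : ℝ × (Fin N → ℝ) => fderiv ℝ (fderiv ℝ (f p.1)) p.2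

/-- The switched dynamics: the mode `f₂` on `[τ, τ + lam)` and the default mode `f₁` elsewhere. -/
def switchedField {N : ℕ} (f₁ f₂ : ℝ → (Fin N → ℝ) → (Fin N → ℝ)) (τ lam : ℝ)
    (t : ℝ) (y : Fin N → ℝ) : Fin N → ℝ :=
  if τ ≤ t ∧ t < τ + lam then f₂ t y else f₁ t y

/-- `x` solves the switched system on `[t₀, tf]` from `x₀`: it is continuous there and its right
derivative is the active mode at every time. For modes continuous in `(t, y)` this is the same as
being continuous and solving the active differential equation off the two switching times. -/
structure IsSwitchedTrajectory {N : ℕ} (f₁ f₂ : ℝ → (Fin N → ℝ) → (Fin N → ℝ))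
    (t₀ tf τ lam : ℝ) (x₀ : Fin N → ℝ) (x : ℝ → (Fin N → ℝ)) : Prop where
  continuousOn : ContinuousOn x (Icc t₀ tf)
  initial : x t₀ = x₀
  ode : ∀ t ∈ Ico t₀ tf, HasDerivWithinAt x (switchedField f₁ f₂ τ lam t (x t)) (Ici t) t

/-- The cost of a trajectory: integrated running cost plus terminal cost. -/
def trajectoryCost {N : ℕ} (l m : (Fin N → ℝ) → ℝ) (t₀ tf : ℝ) (x : ℝ → (Fin N → ℝ)) : ℝ :=
  (∫ t in t₀..tf, l (x t)) + m (x tf)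

/-- The first-order adjoint along `x`:
`ρ' = - (D l)ᵀ - (D f₁)ᵀ ρ` on `[t₀, tf]`, with `ρ (tf) = (D m (x (tf)))ᵀ`. -/
structure IsFirstAdjoint {N : ℕ} (f₁ : ℝ → (Fin N → ℝ) → (Fin N → ℝ))
    (l m : (Fin N → ℝ) → ℝ) (t₀ tf : ℝ) (x ρ : ℝ → (Fin N → ℝ)) : Prop where
  terminal : ρ tf = gradVec m (x tf)
  ode : ∀ t ∈ Icc t₀ tf,
    HasDerivWithinAt ρ (-gradVec l (x t) - (jacobianMatrix (f₁ t) (x t))ᵀ *ᵥ ρ t) (Icc t₀ tf) t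

/-- The second-order adjoint along `x`, stated entry by entry:
`Ω' = - (D f₁)ᵀ Ω - Ω (D f₁) - D² l - ∑ k, ρ_k D² f₁^k` on `[t₀, tf]`,
with `Ω (tf) = (D² m (x (tf)))ᵀ`. -/
structure IsSecondAdjoint {N : ℕ} (f₁ : ℝ → (Fin N → ℝ) → (Fin N → ℝ))
    (l m : (Fin N → ℝ) → ℝ) (t₀ tf : ℝ) (x ρ : ℝ → (Fin N → ℝ))
    (Ω : ℝ → Matrix (Fin N) (Fin N) ℝ) : Prop where
  terminal : Ω tf = (hessianMatrix m (x tf))ᵀ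
  ode : ∀ t ∈ Icc t₀ tf, ∀ i j : Fin N,
    HasDerivWithinAt (fun s => Ω s i j)
      ((-((jacobianMatrix (f₁ t) (x t))ᵀ * Ω t) - Ω t * jacobianMatrix (f₁ t) (x t)
        - hessianMatrix l (x t)
        - ∑ k : Fin N, ρ t k • hessianMatrix (fun y => f₁ t y k) (x t)) i j)
      (Icc t₀ tf) t

/-- The expression
`(f₂ - f₁)ᵀ Ω (f₂ - f₁) + ρᵀ (D f₂ f₂ + D f₁ f₁ - 2 D f₁ f₂) - D l (f₂ - f₁)`,
evaluated at the time `τ` and the state `x τ`. -/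
def modeInsertionHessian {N : ℕ} (f₁ f₂ : ℝ → (Fin N → ℝ) → (Fin N → ℝ))
    (l : (Fin N → ℝ) → ℝ) (τ : ℝ) (x ρ : ℝ → (Fin N → ℝ))
    (Ω : ℝ → Matrix (Fin N) (Fin N) ℝ) : ℝ :=
  (f₂ τ (x τ) - f₁ τ (x τ)) ⬝ᵥ (Ω τ *ᵥ (f₂ τ (x τ) - f₁ τ (x τ)))
    + ρ τ ⬝ᵥ (jacobianMatrix (f₂ τ) (x τ) *ᵥ f₂ τ (x τ)
        + jacobianMatrix (f₁ τ) (x τ) *ᵥ f₁ τ (x τ)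
        - (2 : ℝ) • (jacobianMatrix (f₁ τ) (x τ) *ᵥ f₂ τ (x τ)))
    - gradVec l (x τ) ⬝ᵥ (f₂ τ (x τ) - f₁ τ (x τ))

end

/-! The running cost is absorbed into the state: with the extra component `∫ l`, the cost becomes
the terminal cost `m p.1 + p.2` of an augmented system on `[τ, tf]`, up to the constant accumulated
before `τ`.

Near the default trajectory, let `Ψ z` be the solution of the first mode on `[τ, tf]` starting at
`z`. The integral equation `u - volterra (F₁ ∘ u) = const z` is a `C²` equation in the Banach space
of continuous curves, and its linearization is invertible because Volterra operators are
quasinilpotent. The inverse function theorem therefore makes `Ψ` a `C²` map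
(`IsC2Field.exists_solutionFamily`), and differentiating the equation gives the two variational
equations.

The inserted mode is handled by variation of constants (`exists_insertion_curve`). Write the
trajectory that follows `F₂` as `Ψ (g t) t`. This forces `DΨ(g)(t) g' = F₂ - F₁`, that is `g' = Y
(F₂ - F₁)`, where `Y` solves `Y' = -Y F₁'` and is the inverse of the state derivative of the flow.
The right-hand side is `C¹` in `g`, so `g` exists; and `g'` is differentiable in time because `F₂ -
F₁` is. Switching back at `τ + λ` freezes the parameter, so the final state is `Ψ (g (τ + λ)) tf`.
The fixed map `W = M ∘ Ψ(·)(tf)` then gives `J'' = W''(g', g') + W' g''`. At `τ` one has `g' = F₂ -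
F₁` and `g'' = d + F₂' F₂ + F₁' F₁ - 2 F₁' F₂`.

`W'` and `W''` are expressed by solutions of the variational equations. The adjoints pair with these
to constants of motion (`IsFirstAdjoint.duality`, `IsSecondAdjoint.duality`), which moves the
evaluation from `tf` to `τ` and produces the formula. -/

set_option linter.unusedSectionVars false

/-! ### Superposition operators on spaces of continuous curves. -/

section Superposition

variable {K E G H : Type*} [TopologicalSpace K] [CompactSpace K]
  [NormedAddCommGroup E] [NormedSpace ℝ E] [NormedAddCommGroup G] [NormedSpace ℝ G]
  [NormedAddCommGroup H] [NormedSpace ℝ H]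

/-- The superposition (Nemytskii) operator `u ↦ (s ↦ F (s, u s))`. -/
def superposition (F : C(K × E, H)) (u : C(K, E)) : C(K, H) :=
  F.comp ((ContinuousMap.id K).prodMk u)

@[simp]
theorem superposition_apply (F : C(K × E, H)) (u : C(K, E)) (s : K) :
    superposition F u s = F (s, u s) := rfl

/-- On compact `K` the norm topology is the compact-open one, so continuity is formal and needs no
estimate. -/
theorem continuous_superposition (F : C(K × E, H)) : Continuous (superposition F) := by
  unfold superposition
  exact (ContinuousMap.continuous_postcomp F).comp
    (ContinuousMap.continuous_of_continuous_uncurry _ (by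
      change Continuous fun p : C(K, E) × K => (p.2, p.1 p.2)
      fun_prop))

/-- Pointwise application of a continuous family of operators, as a bounded bilinear map. -/
noncomputable def pointwiseBilin (B : E →L[ℝ] G →L[ℝ] H) : C(K, E) →L[ℝ] C(K, G) →L[ℝ] C(K, H) :=
  LinearMap.mkContinuous₂
    (LinearMap.mk₂ ℝ (fun (A : C(K, E)) (u : C(K, G)) => (⟨fun s => B (A s) (u s), by fun_prop⟩ : C(K, H)))
      (fun A A' u => by ext s; simp)
      (fun c A u => by ext s; simp)
      (fun A u u' => by ext s; simp)
      (fun c A u => by ext s; simp)) ‖B‖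
    (fun A u => by
      refine (ContinuousMap.norm_le _ (by positivity)).2 fun s => ?_
      refine (B.le_opNorm₂ (A s) (u s)).trans ?_
      gcongr
      · exact A.norm_coe_le_norm s
      · exact u.norm_coe_le_norm s)

@[simp]
theorem pointwiseBilin_apply (B : E →L[ℝ] G →L[ℝ] H) (A : C(K, E)) (u : C(K, G)) (s : K) :
    pointwiseBilin B A u s = B (A s) (u s) := rfl

/-- Pointwise application of a continuous family of operators. -/
noncomputable abbrev pointwiseApply : C(K, E →L[ℝ] H) →L[ℝ] C(K, E) →L[ℝ] C(K, H) :=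
  pointwiseBilin (ContinuousLinearMap.id ℝ (E →L[ℝ] H))

theorem contDiff_pointwiseApply {n : WithTop ℕ∞} : ContDiff ℝ n fun A : C(K, E →L[ℝ] H) =>
    (pointwiseApply A : C(K, E) →L[ℝ] C(K, H)) := by
  have := ContinuousLinearMap.contDiff (𝕜 := ℝ) (n := n) (E := C(K, E →L[ℝ] H))
    (F := C(K, E) →L[ℝ] C(K, H)) pointwiseApply
  exact this

/-- The mean value inequality is applied at each `s` on the segment from `u s` to `u s + v s`. Its
error is uniform in `s` because `superposition F'` is continuous at `u` in the sup norm. -/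
theorem hasFDerivAt_superposition (F : C(K × E, H)) (F' : C(K × E, E →L[ℝ] H))
    (hF : ∀ s y, HasFDerivAt (fun z => F (s, z)) (F' (s, y)) y) (u : C(K, E)) :
    HasFDerivAt (superposition F) (pointwiseApply (superposition F' u)) u := by
  rw [hasFDerivAt_iff_isLittleO_nhds_zero, Asymptotics.isLittleO_iff]
  intro c hc
  have hcont := (continuous_superposition F').continuousAt (x := u)
  obtain ⟨δ, hδ, hball⟩ := Metric.continuousAt_iff.1 hcont c hc
  filter_upwards [Metric.ball_mem_nhds (0 : C(K, E)) hδ] with v hv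
  rw [mem_ball_zero_iff] at hv
  refine (ContinuousMap.norm_le _ (by positivity)).2 fun s => ?_
  have key : ∀ y ∈ segment ℝ (u s) (u s + v s), ‖F' (s, y) - F' (s, u s)‖ ≤ c := by
    intro y hy
    rw [segment_eq_image'] at hy
    obtain ⟨θ, ⟨h0, h1⟩, rfl⟩ := hy
    have hd : dist (u + θ • v) u < δ := by
      rw [dist_eq_norm, add_sub_cancel_left, norm_smul, Real.norm_of_nonneg h0]
      exact (mul_le_of_le_one_left (norm_nonneg _) h1).trans_lt hv
    have h2 := (ContinuousMap.dist_apply_le_dist s).trans_lt (hball hd)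
    rw [dist_eq_norm] at h2
    simpa using h2.le
  have := Convex.norm_image_sub_le_of_norm_hasFDerivWithin_le'
    (f := fun z => F (s, z)) (f' := fun y => F' (s, y)) (φ := F' (s, u s))
    (fun y _ => (hF s y).hasFDerivWithinAt) key (convex_segment _ _)
    (left_mem_segment ℝ _ _) (right_mem_segment ℝ _ _)
  simp only [add_sub_cancel_left] at this
  simpa using this.trans (by gcongr; exact v.norm_coe_le_norm s)

theorem contDiff_one_superposition (F : C(K × E, H)) (F' : C(K × E, E →L[ℝ] H))
    (hF : ∀ s y, HasFDerivAt (fun z => F (s, z)) (F' (s, y)) y) :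
    ContDiff ℝ 1 (superposition F) :=
  contDiff_one_iff_hasFDerivAt.2 ⟨_, pointwiseApply.continuous.comp (continuous_superposition F'),
    hasFDerivAt_superposition F F' hF⟩

/-- The derivative is again a superposition operator followed by a bounded linear map, so the `C¹`
result for `F'` finishes. -/
theorem contDiff_two_superposition (F : C(K × E, H)) (F' : C(K × E, E →L[ℝ] H))
    (F'' : C(K × E, E →L[ℝ] E →L[ℝ] H))
    (hF : ∀ s y, HasFDerivAt (fun z => F (s, z)) (F' (s, y)) y)
    (hF' : ∀ s y, HasFDerivAt (fun z => F' (s, z)) (F'' (s, y)) y) :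
    ContDiff ℝ 2 (superposition F) := by
  refine contDiff_succ_iff_hasFDerivAt (n := 1).2
    ⟨fun u => pointwiseApply (superposition F' u), ?_, hasFDerivAt_superposition F F' hF⟩
  rw [Nat.cast_one]
  exact contDiff_pointwiseApply.comp (contDiff_one_superposition F' F'' hF')

end Superposition

/-! ### Volterra operators and their quasinilpotence. -/

section Volterra

variable {a b : ℝ} {E : Type*} [NormedAddCommGroup E] [NormedSpace ℝ E]

/-- The integral of `u` from the left end point. -/
noncomputable def volterra (h : a ≤ b) : C(Icc a b, E) →L[ℝ] C(Icc a b, E) :=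
  LinearMap.mkContinuous
    { toFun := fun u => ⟨fun t => ∫ s in a..t, IccExtend h u s, by
        have : Continuous (IccExtend h u) := u.continuous.Icc_extend'
        exact (intervalIntegral.continuous_primitive (fun _ _ => this.intervalIntegrable _ _) a).comp
          continuous_subtype_val⟩
      map_add' := fun u v => by
        ext t
        have hu : Continuous (IccExtend h u) := u.continuous.Icc_extend'
        have hv : Continuous (IccExtend h v) := v.continuous.Icc_extend'
        exact intervalIntegral.integral_add (hu.intervalIntegrable a t) (hv.intervalIntegrable a t)
      map_smul' := fun c u => by
        ext t
        exact intervalIntegral.integral_smul c (IccExtend h u) }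
    (b - a) (fun u => by
      refine (ContinuousMap.norm_le _ (mul_nonneg (sub_nonneg.2 h) (norm_nonneg _))).2 fun t => ?_
      have := intervalIntegral.norm_integral_le_of_norm_le_const (a := a) (b := t) (C := ‖u‖)
        (f := IccExtend h u) (fun s _ => u.norm_coe_le_norm _)
      refine this.trans ?_
      rw [mul_comm, abs_of_nonneg (sub_nonneg.2 t.2.1)]
      gcongr
      exact t.2.2)

theorem volterra_apply (h : a ≤ b) (u : C(Icc a b, E)) (t : Icc a b) :
    volterra h u t = ∫ s in a..t, IccExtend h u s := rfl

/-- Each integration of `(s - a) ^ n` contributes a factor `1 / (n + 1)`, and these accumulate to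
the factorial. -/
theorem norm_volterra_comp_pow_apply_le (h : a ≤ b) (A : C(Icc a b, E →L[ℝ] E)) (n : ℕ)
    (u : C(Icc a b, E)) (t : Icc a b) :
    ‖((volterra h ∘L pointwiseApply A) ^ n) u t‖ ≤ (‖A‖ * (t - a)) ^ n / n.factorial * ‖u‖ := by
  induction n generalizing t with
  | zero => simpa using u.norm_coe_le_norm t
  | succ n ih =>
    rw [pow_succ', mul_apply_eq_comp]
    set w := ((volterra h ∘L pointwiseApply A) ^ n) u with hw
    rw [ContinuousLinearMap.comp_apply, volterra_apply]
    have hb : ∀ s ∈ Ioc a (t : ℝ), ‖IccExtend h (pointwiseApply A w) s‖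
        ≤ ‖A‖ * ((‖A‖ * (s - a)) ^ n / n.factorial * ‖u‖) := by
      intro s hs
      have hs' : s ∈ Icc a b := ⟨hs.1.le, hs.2.trans t.2.2⟩
      rw [IccExtend_of_mem h _ hs']
      refine ((A ⟨s, hs'⟩).le_opNorm _).trans ?_
      gcongr
      · exact A.norm_coe_le_norm _
      · exact ih ⟨s, hs'⟩
    have := intervalIntegral.norm_integral_le_of_norm_le t.2.1
      (MeasureTheory.ae_of_all _ hb) (Continuous.intervalIntegrable (μ := MeasureTheory.volume) (by fun_prop) _ _)
    refine this.trans (le_of_eq ?_)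
    have e : ∀ s : ℝ, ‖A‖ * ((‖A‖ * (s - a)) ^ n / n.factorial * ‖u‖)
        = (‖A‖ ^ (n + 1) / n.factorial * ‖u‖) * (s - a) ^ n := by
      intro s; rw [mul_pow]; ring
    simp_rw [e]
    rw [intervalIntegral.integral_const_mul, intervalIntegral.integral_comp_sub_right (fun s => s ^ n) a,
      integral_pow, Nat.factorial_succ, mul_pow]
    push_cast
    field_simp
    ring

/-- The operator `T` itself need not be a contraction, but some power is. Since `1 - T ^ n` is the
product of `1 - T` and a geometric sum commuting with it, `1 - T` is a unit, with no smallness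
condition on `b - a`. -/
theorem isUnit_one_sub_volterra_comp (h : a ≤ b) (A : C(Icc a b, E →L[ℝ] E)) [CompleteSpace E] :
    IsUnit (1 - volterra h ∘L pointwiseApply A) := by
  set T := volterra h ∘L pointwiseApply A
  obtain ⟨n, hn⟩ := ((FloorSemiring.tendsto_pow_div_factorial_atTop (‖A‖ * (b - a))).eventually
    (gt_mem_nhds one_pos)).exists
  have hT : ‖T ^ n‖ < 1 := by
    refine (ContinuousLinearMap.opNorm_le_bound _ ?_ fun u => ?_).trans_lt hn
    · have := sub_nonneg.2 h
      positivity
    refine (ContinuousMap.norm_le _ ?_).2 fun t => ?_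
    · have := sub_nonneg.2 h
      positivity
    refine (norm_volterra_comp_pow_apply_le h A n u t).trans ?_
    have := sub_nonneg.2 t.2.1
    gcongr
    exact t.2.2
  have hu : IsUnit (1 - T ^ n) := isUnit_one_sub_of_norm_lt_one (R := C(Icc a b, E) →L[ℝ] C(Icc a b, E)) (x := T ^ n) hT
  rw [← mul_neg_geom_sum] at hu
  exact ((Commute.one_left _).sub_left (Commute.sum_right _ _ _ fun i _ => Commute.self_pow T i)
    |>.isUnit_mul_iff.1 hu).1

end Volterra

/-! ### Equivalence of integral and differential equations. -/

section VolterraODE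

variable {a b : ℝ} {E : Type*} [NormedAddCommGroup E] [NormedSpace ℝ E] [CompleteSpace E]

theorem hasDerivWithinAt_of_sub_volterra_eq_const (h : a ≤ b) {u w : C(Icc a b, E)} {z : E}
    (H : u - volterra h w = ContinuousMap.const _ z) {t : ℝ} (ht : t ∈ Icc a b) :
    HasDerivWithinAt (IccExtend h u) (w ⟨t, ht⟩) (Icc a b) t := by
  have hw : Continuous (IccExtend h w) := w.continuous.Icc_extend'
  have h1 : HasDerivAt (fun t => z + ∫ s in a..t, IccExtend h w s) (IccExtend h w t) t :=
    (hw.integral_hasStrictDerivAt a t).hasDerivAt.const_add z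
  rw [IccExtend_of_mem h _ ht] at h1
  have key : ∀ s ∈ Icc a b, IccExtend h u s = z + ∫ r in a..s, IccExtend h w r := by
    intro s hs
    rw [IccExtend_of_mem h _ hs]
    have := DFunLike.congr_fun H ⟨s, hs⟩
    simp only [ContinuousMap.sub_apply, volterra_apply, ContinuousMap.const_apply] at this
    rw [← this, sub_add_cancel]
  exact h1.hasDerivWithinAt.congr key (key t ht)

theorem apply_left_of_sub_volterra_eq_const (h : a ≤ b) {u w : C(Icc a b, E)} {z : E}
    (H : u - volterra h w = ContinuousMap.const _ z) : u ⟨a, left_mem_Icc.2 h⟩ = z := by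
  have := DFunLike.congr_fun H ⟨a, left_mem_Icc.2 h⟩
  simpa [volterra_apply] using this

/-- Right derivatives suffice for the fundamental theorem of calculus, which matches the notion of
switched trajectory. -/
theorem sub_volterra_eq_const (h : a ≤ b) {u w : C(Icc a b, E)}
    (H : ∀ t (ht : t ∈ Ico a b),
      HasDerivWithinAt (IccExtend h u) (w ⟨t, Ico_subset_Icc_self ht⟩) (Ici t) t) :
    u - volterra h w = ContinuousMap.const _ (u ⟨a, left_mem_Icc.2 h⟩) := by
  ext t
  have hw : Continuous (IccExtend h w) := w.continuous.Icc_extend'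
  have hu : Continuous (IccExtend h u) := u.continuous.Icc_extend'
  have := intervalIntegral.integral_eq_sub_of_hasDeriv_right_of_le (f := IccExtend h u)
    (f' := IccExtend h w) t.2.1 hu.continuousOn (fun s hs => by
      have hs' : s ∈ Ico a b := ⟨hs.1.le, hs.2.trans_le t.2.2⟩
      rw [IccExtend_of_mem h _ (Ico_subset_Icc_self hs')]
      exact (H s hs').mono Ioi_subset_Ici_self) (hw.intervalIntegrable _ _)
  simp only [ContinuousMap.sub_apply, volterra_apply, ContinuousMap.const_apply, this]
  rw [IccExtend_of_mem h _ t.2, IccExtend_of_mem h _ (left_mem_Icc.2 h)]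
  simp

end VolterraODE

/-- `F` is a time-dependent vector field that is `C²` in the state, with first and second state
derivatives `F'` and `F''`, all jointly continuous. -/
structure IsC2Field {E : Type*} [NormedAddCommGroup E] [NormedSpace ℝ E] (F : ℝ → E → E)
    (F' : ℝ → E → E →L[ℝ] E) (F'' : ℝ → E → E →L[ℝ] E →L[ℝ] E) : Prop where
  hasFDerivAt : ∀ t y, HasFDerivAt (F t) (F' t y) y
  hasFDerivAt' : ∀ t y, HasFDerivAt (F' t) (F'' t y) y
  continuous : Continuous fun p : ℝ × E => F p.1 p.2
  continuous' : Continuous fun p : ℝ × E => F' p.1 p.2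
  continuous'' : Continuous fun p : ℝ × E => F'' p.1 p.2

/-- A jointly continuous function restricted to times in `[a, b]`. -/
def restrictTime {E H : Type*} [TopologicalSpace E] [TopologicalSpace H] (a b : ℝ) {F : ℝ → E → H}
    (hF : Continuous fun p : ℝ × E => F p.1 p.2) : C(Icc a b × E, H) :=
  ⟨fun p => F p.1 p.2, hF.comp (by fun_prop : Continuous fun p : Icc a b × E => ((p.1 : ℝ), p.2))⟩

@[simp]
theorem restrictTime_apply {E H : Type*} [TopologicalSpace E] [TopologicalSpace H] {a b : ℝ}
    {F : ℝ → E → H} (hF : Continuous fun p : ℝ × E => F p.1 p.2) (p : Icc a b × E) :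
    restrictTime a b hF p = F p.1 p.2 := rfl

/-! ### Smooth dependence on the initial state and the variational equations. -/

section Flow

variable {a b : ℝ} {E : Type*} [NormedAddCommGroup E] [NormedSpace ℝ E] [CompleteSpace E]
  {F : ℝ → E → E} {F' : ℝ → E → E →L[ℝ] E} {F'' : ℝ → E → E →L[ℝ] E →L[ℝ] E}

/-- A `C²` family of solutions near a given one, parametrised by the initial state. -/
theorem IsC2Field.exists_solutionFamily (hF : IsC2Field F F' F'') (h : a ≤ b) {x : C(Icc a b, E)}
    {z₀ : E}
    (hx : x - volterra h (superposition (restrictTime a b hF.continuous) x)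
      = ContinuousMap.const _ z₀) :
    ∃ Ψ : E → C(Icc a b, E), ContDiffAt ℝ 2 Ψ z₀ ∧ Ψ z₀ = x ∧
      ∀ᶠ z in 𝓝 z₀, Ψ z - volterra h (superposition (restrictTime a b hF.continuous) (Ψ z))
        = ContinuousMap.const _ z := by
  -- Solving from the initial state `z` means solving `Φ u = const z`, so the family is the local
  -- inverse of `Φ` restricted to constant curves.
  set Φ : C(Icc a b, E) → C(Icc a b, E) := fun u =>
    u - volterra h (superposition (restrictTime a b hF.continuous) u) with hΦ
  have hΦ2 : ContDiff ℝ 2 Φ := contDiff_id.sub ((volterra (E := E) h).contDiff.comp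
    (contDiff_two_superposition (restrictTime a b hF.continuous) (restrictTime a b hF.continuous') (restrictTime a b hF.continuous'')
      (fun s y => hF.hasFDerivAt s y) (fun s y => hF.hasFDerivAt' s y)))
  obtain ⟨U, hU⟩ := isUnit_one_sub_volterra_comp h
    (superposition (restrictTime a b hF.continuous') x)
  have hΦ' : HasFDerivAt Φ ((ContinuousLinearEquiv.unitsEquiv ℝ _ U : C(Icc a b, E) ≃L[ℝ] C(Icc a b, E)) :
      C(Icc a b, E) →L[ℝ] C(Icc a b, E)) x := by
    have e : ((ContinuousLinearEquiv.unitsEquiv ℝ _ U : C(Icc a b, E) ≃L[ℝ] C(Icc a b, E)) :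
      C(Icc a b, E) →L[ℝ] C(Icc a b, E)) = U := by ext1 u; simp
    rw [e, hU]
    exact (hasFDerivAt_id x).sub ((volterra (E := E) h).hasFDerivAt.comp x (hasFDerivAt_superposition
      (restrictTime a b hF.continuous) (restrictTime a b hF.continuous') (fun s y => hF.hasFDerivAt s y) x))
  have hstrict := hΦ2.contDiffAt.hasStrictFDerivAt' hΦ' two_ne_zero
  set S := hΦ2.contDiffAt.localInverse hΦ' two_ne_zero with hS
  have hS2 := hΦ2.contDiffAt.to_localInverse hΦ' two_ne_zero
  have hΦx : Φ x = ContinuousLinearMap.const ℝ (Icc a b) z₀ := hx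
  refine ⟨fun z => S (ContinuousLinearMap.const ℝ (Icc a b) z), ?_, ?_, ?_⟩
  · rw [hΦx] at hS2
    exact hS2.comp z₀ (ContinuousLinearMap.contDiff _).contDiffAt
  · have := hΦ2.contDiffAt.localInverse_apply_image hΦ' two_ne_zero
    rw [hΦx] at this
    exact this
  · have h1 := hstrict.eventually_right_inverse
    rw [hΦx] at h1
    exact (ContinuousLinearMap.const ℝ (Icc a b) (M := E)).continuous.continuousAt.eventually h1

variable {Ψ : E → C(Icc a b, E)} {z₀ : E}

/-- The first variational equation, in integral form. -/
theorem IsC2Field.fderiv_solutionFamily (hF : IsC2Field F F' F'') (h : a ≤ b)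
    (hΨ : DifferentiableAt ℝ Ψ z₀)
    (hsol : ∀ᶠ z in 𝓝 z₀, Ψ z - volterra h (superposition (restrictTime a b hF.continuous) (Ψ z))
        = ContinuousMap.const _ z) (e : E) :
    fderiv ℝ Ψ z₀ e - volterra h (pointwiseApply
      (superposition (restrictTime a b hF.continuous') (Ψ z₀)) (fderiv ℝ Ψ z₀ e))
      = ContinuousMap.const _ e := by
  have h1 := hΨ.hasFDerivAt.sub ((volterra h).hasFDerivAt.comp z₀ ((hasFDerivAt_superposition
      (restrictTime a b hF.continuous) (restrictTime a b hF.continuous') (fun s y => hF.hasFDerivAt s y) (Ψ z₀)).comp z₀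
        hΨ.hasFDerivAt))
  have h2 := (ContinuousLinearMap.const ℝ (Icc a b) (M := E)).hasFDerivAt (x := z₀)
  exact DFunLike.congr_fun (h1.unique (h2.congr_of_eventuallyEq hsol)) e

/-- The second variational equation, in integral form. -/
theorem IsC2Field.fderiv_fderiv_solutionFamily (hF : IsC2Field F F' F'') (h : a ≤ b)
    (hΨ : ContDiffAt ℝ 2 Ψ z₀)
    (hsol : ∀ᶠ z in 𝓝 z₀, Ψ z - volterra h (superposition (restrictTime a b hF.continuous) (Ψ z))
        = ContinuousMap.const _ z) (e : E) :
    fderiv ℝ (fderiv ℝ Ψ) z₀ e e - volterra h (pointwiseApply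
        (superposition (restrictTime a b hF.continuous') (Ψ z₀)) (fderiv ℝ (fderiv ℝ Ψ) z₀ e e)
      + pointwiseApply (pointwiseApply (superposition (restrictTime a b hF.continuous'') (Ψ z₀))
          (fderiv ℝ Ψ z₀ e)) (fderiv ℝ Ψ z₀ e))
      = ContinuousMap.const _ 0 := by
  have hd : ∀ᶠ z in 𝓝 z₀, DifferentiableAt ℝ Ψ z :=
    (hΨ.eventually (by simp)).mono fun z hz => hz.differentiableAt two_ne_zero
  -- The first variational equation holds for all nearby `z`, hence can itself be differentiated in
  -- `z`.
  have h0 : ∀ᶠ z in 𝓝 z₀, fderiv ℝ Ψ z e - volterra h (pointwiseApply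
      (superposition (restrictTime a b hF.continuous') (Ψ z)) (fderiv ℝ Ψ z e))
      = ContinuousMap.const _ e := by
    filter_upwards [hd, hsol.eventually_nhds] with z hz hz'
    exact hF.fderiv_solutionFamily h hz hz' e
  have hD : DifferentiableAt ℝ (fderiv ℝ Ψ) z₀ :=
    (hΨ.fderiv_right (m := 1) (by norm_num)).differentiableAt one_ne_zero
  have hDe : HasFDerivAt (fun z => fderiv ℝ Ψ z e) ((fderiv ℝ (fderiv ℝ Ψ) z₀).flip e) z₀ :=
    hD.hasFDerivAt.clm_apply (hasFDerivAt_const e z₀) |>.congr_fderiv (by ext1; simp)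
  have hB : HasFDerivAt (fun z => superposition (restrictTime a b hF.continuous') (Ψ z))
      (pointwiseApply (superposition (restrictTime a b hF.continuous'') (Ψ z₀)) ∘L fderiv ℝ Ψ z₀)
      z₀ :=
    (hasFDerivAt_superposition (restrictTime a b hF.continuous')
      (restrictTime a b hF.continuous'')
      (fun s y => hF.hasFDerivAt' s y) (Ψ z₀)).comp z₀ hd.self_of_nhds.hasFDerivAt
  have hA := (pointwiseApply (K := Icc a b) (E := E) (H := E)).hasFDerivAt_of_bilinear hB hDe
  have h1 := hDe.sub (HasFDerivAt.comp z₀ (volterra (E := E) h).hasFDerivAt hA)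
  have h2 := hasFDerivAt_const (𝕜 := ℝ) (ContinuousMap.const (Icc a b) e) z₀
  exact DFunLike.congr_fun (h1.unique (h2.congr_of_eventuallyEq h0)) e

end Flow

/-! ### Chain rule from partial derivatives. -/

section PartialDerivatives

variable {E G : Type*} [NormedAddCommGroup E] [NormedSpace ℝ E]
  [NormedAddCommGroup G] [NormedSpace ℝ G]

/-- The chain rule for `t ↦ f t (c t)` in terms of partial derivatives, within a convex set of times. -/
theorem hasDerivWithinAt_of_partial {S : Set ℝ} (hS : Convex ℝ S) {f f_t : ℝ → E → G} {c : ℝ → E}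
    {c' : E} {f_z : E →L[ℝ] G} {s : ℝ} (hs : s ∈ S)
    (hf : ∀ᶠ z in 𝓝 (c s), ∀ t ∈ S, HasDerivWithinAt (fun r => f r z) (f_t t z) S t)
    (hcont : ContinuousWithinAt (fun p : ℝ × E => f_t p.1 p.2) (S ×ˢ univ) (s, c s))
    (hf_z : HasFDerivAt (f s) f_z (c s)) (hc : HasDerivWithinAt c c' S s) :
    HasDerivWithinAt (fun t => f t (c t)) (f_t s (c s) + f_z c') S s := by
  have h2 : HasDerivWithinAt (fun t => f s (c t)) (f_z c') S s := hf_z.comp_hasDerivWithinAt s hc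
  -- The increment in time is taken at the moving point `c t`. After subtracting the linear function
  -- `r • f_t s (c s)`, the mean value inequality bounds it by `ε * |t - s|`; the rest uses the
  -- state derivative at the single time `s`.
  have h1 : HasDerivWithinAt (fun t => f t (c t) - f s (c t)) (f_t s (c s)) S s := by
    rw [hasDerivWithinAt_iff_isLittleO, Asymptotics.isLittleO_iff]
    intro ε hε
    obtain ⟨δ, hδ, hb⟩ := Metric.continuousWithinAt_iff.1 hcont ε hε
    filter_upwards [hc.continuousWithinAt.eventually hf,
      hc.continuousWithinAt.eventually (Metric.ball_mem_nhds _ hδ), self_mem_nhdsWithin,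
      mem_nhdsWithin_of_mem_nhds (Metric.ball_mem_nhds s hδ)] with t ht htδ htS hts
    have hd : ∀ r ∈ S ∩ Metric.ball s δ, HasDerivWithinAt
        (fun r => f r (c t) - r • f_t s (c s)) (f_t r (c t) - f_t s (c s)) (S ∩ Metric.ball s δ) r := by
      intro r hr
      have := ((hasDerivAt_id r).smul_const (f_t s (c s))).hasDerivWithinAt (s := S)
      rw [one_smul] at this
      exact ((ht r hr.1).sub this).mono inter_subset_left
    have hbd : ∀ r ∈ S ∩ Metric.ball s δ, ‖f_t r (c t) - f_t s (c s)‖ ≤ ε := by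
      intro r hr
      rw [← dist_eq_norm]
      refine (hb (x := (r, c t)) ⟨hr.1, mem_univ _⟩ ?_).le
      rw [Prod.dist_eq]
      exact max_lt hr.2 htδ
    have := (hS.inter (convex_ball s δ)).norm_image_sub_le_of_norm_hasDerivWithin_le hd hbd
      ⟨hs, Metric.mem_ball_self hδ⟩ ⟨htS, hts⟩
    convert this using 2
    rw [sub_smul]
    abel
  convert h1.add h2 using 1
  ext t
  simp

theorem continuousAt_IccExtend_uncurry {X : Type*} [TopologicalSpace X] {a b : ℝ} (h : a ≤ b)
    {Ψ : X → C(Icc a b, E)} {z : X} (hΨ : ContinuousAt Ψ z) (t : ℝ) :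
    ContinuousAt (fun p : ℝ × X => IccExtend h (Ψ p.2) p.1) (t, z) := by
  have h1 : ContinuousAt (fun p : ℝ × X => (Ψ p.2, projIcc a b h p.1)) (t, z) :=
    (ContinuousAt.comp (f := Prod.snd) (x := (t, z)) hΨ continuousAt_snd).prodMk
      (continuous_projIcc.comp continuous_fst).continuousAt
  exact (continuous_eval (F := C(Icc a b, E))).continuousAt.comp h1

end PartialDerivatives

/-! ### Inverse of the linearized flow, and local solvability for the parameter curve. -/

section Flow

variable {a b : ℝ} {E : Type*} [NormedAddCommGroup E] [NormedSpace ℝ E] [CompleteSpace E]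
  {F : ℝ → E → E} {F' : ℝ → E → E →L[ℝ] E} {F'' : ℝ → E → E →L[ℝ] E →L[ℝ] E}
  {Ψ : E → C(Icc a b, E)} {z₀ : E}

/-- Solutions of a linear equation `Y' = B(t, Ψ(z)) Y` along a `C¹` family of curves are a `C¹`
family of curves. -/
theorem exists_linearFamily {G : Type*} [NormedAddCommGroup G] [NormedSpace ℝ G] [CompleteSpace G]
    {B : ℝ → E → G →L[ℝ] G} {B' : ℝ → E → E →L[ℝ] G →L[ℝ] G}
    (hB : Continuous fun p : ℝ × E => B p.1 p.2) (hB' : Continuous fun p : ℝ × E => B' p.1 p.2)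
    (hBB' : ∀ t y, HasFDerivAt (B t) (B' t y) y) (h : a ≤ b) (hΨ : ContDiffAt ℝ 1 Ψ z₀) (y₀ : G) :
    ∃ Y : E → C(Icc a b, G), ContDiffAt ℝ 1 Y z₀ ∧
      ∀ z, Y z - volterra h (pointwiseApply (superposition (restrictTime a b hB) (Ψ z)) (Y z))
        = ContinuousMap.const _ y₀ := by
  set T : E → C(Icc a b, G) →L[ℝ] C(Icc a b, G) := fun z =>
    volterra h ∘L pointwiseApply (superposition (restrictTime a b hB) (Ψ z)) with hT
  have hunit : ∀ z, IsUnit (1 - T z) := fun z => isUnit_one_sub_volterra_comp h _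
  have hTd : ContDiffAt ℝ 1 T z₀ := by
    have h1 : ContDiffAt ℝ 1 (fun z => superposition (restrictTime a b hB) (Ψ z)) z₀ :=
      ((contDiff_one_superposition (restrictTime a b hB) (restrictTime a b hB')
        (fun s y => hBB' s y)).contDiffAt).comp z₀ hΨ
    have h3 := (contDiff_pointwiseApply (K := Icc a b) (E := G) (H := G)).contDiffAt.comp z₀ h1
    exact contDiffAt_const.clm_comp h3
  -- The solution is `(1 - T z)⁻¹` applied to a constant curve, and inversion is smooth at units.
  refine ⟨fun z => Ring.inverse (1 - T z) (ContinuousMap.const _ y₀), ?_, fun z => ?_⟩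
  · obtain ⟨U, hU⟩ := hunit z₀
    have := contDiffAt_ringInverse ℝ (n := 1) (R := C(Icc a b, G) →L[ℝ] C(Icc a b, G)) U
    rw [hU] at this
    exact (ContDiffAt.comp z₀ this (contDiffAt_const.sub hTd)).clm_apply contDiffAt_const
  · exact DFunLike.congr_fun (Ring.mul_inverse_cancel _ (hunit z))
      (ContinuousMap.const (Icc a b) y₀)

/-- The operator `Y ↦ -Y ∘ B`, as a function of `B`. -/
noncomputable def negCompRight (E : Type*) [NormedAddCommGroup E] [NormedSpace ℝ E] :
    (E →L[ℝ] E) →L[ℝ] (E →L[ℝ] E) →L[ℝ] (E →L[ℝ] E) :=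
  -(ContinuousLinearMap.compL ℝ E E E).flip

@[simp]
theorem negCompRight_apply (B Y : E →L[ℝ] E) : negCompRight E B Y = -(Y ∘L B) := rfl

theorem IsC2Field.continuous_negCompRight (hF : IsC2Field F F' F'') :
    Continuous fun p : ℝ × E => negCompRight E (F' p.1 p.2) :=
  (negCompRight E).continuous.comp hF.continuous'

/-- The fundamental solution of the equation `Y' = -Y ∘ F'` along a `C¹` family of curves is a `C¹`
family of curves. -/
theorem IsC2Field.exists_inverseFamily (hF : IsC2Field F F' F'') (h : a ≤ b)
    (hΨ : ContDiffAt ℝ 1 Ψ z₀) :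
    ∃ Y : E → C(Icc a b, E →L[ℝ] E), ContDiffAt ℝ 1 Y z₀ ∧
      ∀ z, Y z - volterra h (pointwiseApply (superposition
        (restrictTime a b (F := fun t y => negCompRight E (F' t y)) hF.continuous_negCompRight) (Ψ z)) (Y z)) = ContinuousMap.const _ 1 :=
  exists_linearFamily (B' := fun t y => negCompRight E ∘L F'' t y) hF.continuous_negCompRight
    (continuous_const.clm_comp hF.continuous'')
    (fun t y => (negCompRight E).hasFDerivAt.comp y (hF.hasFDerivAt' t y)) h hΨ 1

/-- With `v = DΨ e`, the derivative of `Y v` is `-Y F' v + Y F' v = 0`, and `Y v = e` at the left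
end point. -/
theorem IsC2Field.inverse_apply_fderiv (hF : IsC2Field F F' F'') (h : a ≤ b)
    (hΨ : DifferentiableAt ℝ Ψ z₀)
    (hsol : ∀ᶠ z in 𝓝 z₀, Ψ z - volterra h (superposition (restrictTime a b hF.continuous) (Ψ z))
        = ContinuousMap.const _ z) {Y : C(Icc a b, E →L[ℝ] E)}
    (hY : Y - volterra h (pointwiseApply (superposition
        (restrictTime a b (F := fun t y => negCompRight E (F' t y)) hF.continuous_negCompRight) (Ψ z₀)) Y) = ContinuousMap.const _ 1)
    (t : Icc a b) (e : E) : Y t (fderiv ℝ Ψ z₀ e t) = e := by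
  have hv := hF.fderiv_solutionFamily h hΨ hsol e
  set v := fderiv ℝ Ψ z₀ e
  have hd : ∀ s ∈ Icc a b, HasDerivWithinAt (fun s => IccExtend h Y s (IccExtend h v s)) 0
      (Icc a b) s := by
    intro s hs
    have := (hasDerivWithinAt_of_sub_volterra_eq_const h hY hs).clm_apply
      (hasDerivWithinAt_of_sub_volterra_eq_const h hv hs)
    convert this using 1
    simp [IccExtend_of_mem h _ hs]
  have := constant_of_has_deriv_right_zero (fun s hs => (hd s hs).continuousWithinAt)
    (fun s hs => (hd s (Ico_subset_Icc_self hs)).mono_of_mem_nhdsWithin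
      (Icc_mem_nhdsGE_of_mem hs)) t t.2
  simp only [IccExtend_of_mem h _ t.2, IccExtend_of_mem h _ (left_mem_Icc.2 h)] at this
  rw [apply_left_of_sub_volterra_eq_const h hY, apply_left_of_sub_volterra_eq_const h hv] at this
  simpa using this

/-- In finite dimension a left inverse is a right inverse. -/
theorem IsC2Field.fderiv_apply_inverse [FiniteDimensional ℝ E] (hF : IsC2Field F F' F'') (h : a ≤ b)
    (hΨ : DifferentiableAt ℝ Ψ z₀)
    (hsol : ∀ᶠ z in 𝓝 z₀, Ψ z - volterra h (superposition (restrictTime a b hF.continuous) (Ψ z))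
        = ContinuousMap.const _ z) {Y : C(Icc a b, E →L[ℝ] E)}
    (hY : Y - volterra h (pointwiseApply (superposition
        (restrictTime a b (F := fun t y => negCompRight E (F' t y)) hF.continuous_negCompRight) (Ψ z₀)) Y) = ContinuousMap.const _ 1)
    (t : Icc a b) (e : E) : fderiv ℝ Ψ z₀ (Y t e) t = e := by
  have h1 : (Y t : E →ₗ[ℝ] E) * ((ContinuousMap.evalCLM ℝ t ∘L fderiv ℝ Ψ z₀ : E →L[ℝ] E) : E →ₗ[ℝ] E)
      = 1 := by
    ext e
    exact hF.inverse_apply_fderiv h hΨ hsol hY t e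
  exact DFunLike.congr_fun (mul_eq_one_symm h1) e

/-- Local solvability of `g' = H(g)(t)` for a `C¹` family `H` of curves. -/
theorem exists_local_solution_of_contDiffAt (hab : a < b) {H : E → C(Icc a b, E)}
    (hH : ContDiffAt ℝ 1 H z₀) {U : Set E} (hU : U ∈ 𝓝 z₀) {δ : ℝ} (hδ : 0 < δ) :
    ∃ ε, 0 < ε ∧ ε ≤ δ ∧ a + ε ≤ b ∧ ∃ g : ℝ → E, g a = z₀ ∧ ∀ t ∈ Icc a (a + ε), g t ∈ U ∧
      HasDerivWithinAt g (IccExtend hab.le (H (g t)) t) (Icc a (a + ε)) t := by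
  obtain ⟨K, s, hs, hK⟩ := hH.exists_lipschitzOnWith
  have hn : ∀ᶠ z in 𝓝 z₀, ‖H z‖ < ‖H z₀‖ + 1 :=
    hH.continuousAt.norm.eventually (gt_mem_nhds (lt_add_one _))
  obtain ⟨ρ, hρ, hball⟩ := Metric.nhds_basis_closedBall.mem_iff.1 (inter_mem hs hn)
  set L : ℝ := ‖H z₀‖ + 1 with hL
  have hLpos : 0 < L := by positivity
  -- The bound `ρ / L` keeps a curve of speed at most `L` inside the ball of radius `ρ`.
  set η := min δ (min (b - a) (ρ / L)) with hη
  have hηpos : 0 < η := lt_min hδ (lt_min (sub_pos.2 hab) (by positivity))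
  have hηb : a + η ≤ b := by
    have := (min_le_right δ _).trans (min_le_left (b - a) (ρ / L))
    linarith
  have hPL : IsPicardLindelof (fun t z => IccExtend hab.le (H z) t)
      (⟨a, left_mem_Icc.2 (by linarith)⟩ : Icc a (a + η)) z₀ ⟨ρ, hρ.le⟩ 0 ⟨L, hLpos.le⟩ K := by
    refine ⟨fun t _ => ?_, fun z _ => (H z).continuous.Icc_extend'.continuousOn, fun t _ z hz => ?_,
      ?_⟩
    · refine LipschitzOnWith.of_dist_le_mul fun y hy z hz => ?_
      exact (ContinuousMap.dist_apply_le_dist _).trans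
        (hK.dist_le_mul y (hball hy).1 z (hball hz).1)
    · exact ((H z).norm_coe_le_norm _).trans (hball hz).2.le
    · simp only [add_sub_cancel_left, sub_self, NNReal.coe_zero, sub_zero, max_eq_left hηpos.le]
      change L * η ≤ ρ
      rw [mul_comm, ← le_div_iff₀ hLpos]
      exact (min_le_right _ _).trans (min_le_right _ _)
  obtain ⟨g, hg0, hg⟩ := hPL.exists_eq_forall_mem_Icc_hasDerivWithinAt₀
  have hcont := (hg a (left_mem_Icc.2 (by linarith))).continuousWithinAt
  have hev : ∀ᶠ t in 𝓝[Icc a (a + η)] a, g t ∈ U := hcont (by rw [show g a = z₀ from hg0]; exact hU)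
  -- Continuity at `a` allows a second shortening, to `min η (θ / 2)`, that keeps `g` in `U`.
  obtain ⟨θ, hθ, hsub⟩ := Metric.mem_nhdsWithin_iff.1 hev
  have hsub2 : ∀ {t}, t ∈ Icc a (a + min η (θ / 2)) → t ∈ Icc a (a + η) := fun ht =>
    ⟨ht.1, ht.2.trans (by gcongr; exact min_le_left _ _)⟩
  refine ⟨min η (θ / 2), lt_min hηpos (by positivity), (min_le_left _ _).trans (min_le_left _ _),
    (by linarith [min_le_left η (θ / 2)]), g, hg0, fun t ht => ⟨?_, ?_⟩⟩
  · refine hsub ⟨?_, hsub2 ht⟩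
    rw [Metric.mem_ball, Real.dist_eq, abs_of_nonneg (sub_nonneg.2 ht.1)]
    linarith [ht.2, min_le_right η (θ / 2)]
  · exact (hg t (hsub2 ht)).mono fun _ => hsub2

end Flow

/-! ### Variation of constants for the inserted mode. -/

section Insertion

variable {a b : ℝ} {E G : Type*} [NormedAddCommGroup E] [NormedSpace ℝ E] [CompleteSpace E]
  [NormedAddCommGroup G] [NormedSpace ℝ G] [CompleteSpace G]
  {F : ℝ → E → E} {F' : ℝ → E → E →L[ℝ] E} {F'' : ℝ → E → E →L[ℝ] E →L[ℝ] E}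

/-- The derivative of `t ↦ U (g t) t` for a family `U` of primitives. -/
theorem hasDerivWithinAt_family_comp (h : a ≤ b) {S : Set ℝ} (hS : Convex ℝ S) (hSab : S ⊆ Icc a b)
    {U V : E → C(Icc a b, G)} {c : E → G} {g : ℝ → E} {k : E} {s : ℝ} (hs : s ∈ S)
    (hg : HasDerivWithinAt g k S s)
    (hU : ∀ᶠ z in 𝓝 (g s), U z - volterra h (V z) = ContinuousMap.const _ (c z))
    (hV : ContinuousAt V (g s)) (hUd : DifferentiableAt ℝ U (g s)) :
    HasDerivWithinAt (fun t => IccExtend h (U (g t)) t)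
      (V (g s) ⟨s, hSab hs⟩ + fderiv ℝ U (g s) k ⟨s, hSab hs⟩) S s := by
  have := hasDerivWithinAt_of_partial (f := fun t z => IccExtend h (U z) t)
    (f_t := fun t z => IccExtend h (V z) t)
    (f_z := ContinuousMap.evalCLM ℝ ⟨s, hSab hs⟩ ∘L fderiv ℝ U (g s)) hS hs
    (hU.mono fun z hz t ht => ?_) (continuousAt_IccExtend_uncurry h hV s).continuousWithinAt ?_ hg
  · simpa only [IccExtend_of_mem h _ (hSab hs)] using! this
  · rw [IccExtend_of_mem h _ (hSab ht)]
    exact (hasDerivWithinAt_of_sub_volterra_eq_const h hz (hSab ht)).mono hSab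
  · simp only [IccExtend_of_mem h _ (hSab hs)]
    exact (ContinuousMap.evalCLM ℝ (⟨s, hSab hs⟩ : Icc a b)).hasFDerivAt.comp (g s) hUd.hasFDerivAt

theorem continuousWithinAt_IccExtend_apply (h : a ≤ b) {S : Set ℝ} {s : ℝ}
    {q : ℝ → C(Icc a b, G)} (hq : ContinuousWithinAt q S s) :
    ContinuousWithinAt (fun t => IccExtend h (q t) t) S s :=
  (continuousAt_IccExtend_uncurry (Ψ := id) h continuousAt_id s).comp_continuousWithinAt
    (f := fun t => (t, q t)) (continuousWithinAt_id.prodMk hq)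

theorem fderiv_terminal {M : G → ℝ} {ψ : E → G} {ψ' : E → E →L[ℝ] G}
    {ψ'' : E →L[ℝ] E →L[ℝ] G} {z : E} (hM' : Differentiable ℝ (fderiv ℝ M))
    (hψ : HasFDerivAt ψ (ψ' z) z) (hψ' : HasFDerivAt ψ' ψ'' z) (e : E) :
    fderiv ℝ (fun z => fderiv ℝ M (ψ z) ∘L ψ' z) z e e
      = fderiv ℝ (fderiv ℝ M) (ψ z) (ψ' z e) (ψ' z e) + fderiv ℝ M (ψ z) (ψ'' e e) := by
  have h1 := ((hM' (ψ z)).hasFDerivAt.comp z hψ).clm_comp hψ'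
  refine (DFunLike.congr_fun (DFunLike.congr_fun (HasFDerivAt.fderiv h1) e) e).trans ?_
  simp [add_comm]

variable {F₁ F₂ : ℝ → E → E} {F₁' F₂' : ℝ → E → E →L[ℝ] E} {F₁'' F₂'' : ℝ → E → E →L[ℝ] E →L[ℝ] E}

/-- Variation of constants for the insertion of the mode `F₂` into the mode `F₁`: along the curve
that follows `F₂` on `[a, a + ε]`, the initial state `g` of the `F₁`-solution through its current
point is twice continuously differentiable. -/
theorem exists_insertion_curve [FiniteDimensional ℝ E] (h₁ : IsC2Field F₁ F₁' F₁'')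
    (h₂ : IsC2Field F₂ F₂' F₂'') (hab : a < b) {r : ℝ} (hr : 0 < r) {d : ℝ → E → E}
    (hd : ∀ t ∈ Icc a (a + r), ∀ y,
      HasDerivWithinAt (fun s => F₂ s y - F₁ s y) (d t y) (Icc a (a + r)) t)
    (hdc : ContinuousOn (fun p : ℝ × E => d p.1 p.2) (Icc a (a + r) ×ˢ univ))
    {x : C(Icc a b, E)} {z₀ : E}
    (hx : x - volterra hab.le (superposition (restrictTime a b h₁.continuous) x)
      = ContinuousMap.const _ z₀) :
    ∃ ε, 0 < ε ∧ ε ≤ r ∧ a + ε ≤ b ∧ ∃ (Ψ : E → C(Icc a b, E)) (g k k' : ℝ → E),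
      Ψ z₀ = x ∧ g a = z₀ ∧ k a = F₂ a z₀ - F₁ a z₀ ∧
      k' a = d a z₀ + F₂' a z₀ (F₂ a z₀) + F₁' a z₀ (F₁ a z₀) - (2 : ℝ) • F₁' a z₀ (F₂ a z₀) ∧
      ContinuousOn k' (Icc a (a + ε)) ∧
      ∀ s ∈ Icc a (a + ε), ContDiffAt ℝ 2 Ψ (g s) ∧
        (∀ᶠ z in 𝓝 (g s), Ψ z - volterra hab.le
          (superposition (restrictTime a b h₁.continuous) (Ψ z)) = ContinuousMap.const _ z) ∧
        HasDerivWithinAt g (k s) (Icc a (a + ε)) s ∧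
        HasDerivWithinAt k (k' s) (Icc a (a + ε)) s ∧
        HasDerivWithinAt (fun t => IccExtend hab.le (Ψ (g t)) t)
          (F₂ s (IccExtend hab.le (Ψ (g s)) s)) (Icc a (a + ε)) s := by
  obtain ⟨Ψ, hΨ, hΨx, hsol⟩ := h₁.exists_solutionFamily hab.le hx
  obtain ⟨Y, hY, hYsol⟩ := h₁.exists_inverseFamily hab.le (hΨ.of_le (by norm_num))
  have hΔc : Continuous fun p : ℝ × E => F₂ p.1 p.2 - F₁ p.1 p.2 := h₂.continuous.sub h₁.continuous
  have hΔc' : Continuous fun p : ℝ × E => F₂' p.1 p.2 - F₁' p.1 p.2 :=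
    h₂.continuous'.sub h₁.continuous'
  have hΔd : ∀ t y, HasFDerivAt (fun y => F₂ t y - F₁ t y) (F₂' t y - F₁' t y) y := fun t y =>
    (h₂.hasFDerivAt t y).sub (h₁.hasFDerivAt t y)
  set D : E → C(Icc a b, E) := fun z =>
    superposition (restrictTime a b (F := fun t y => F₂ t y - F₁ t y) hΔc) (Ψ z) with hD
  -- With `g' = H (g) t`, moving the parameter contributes `DΨ Y (F₂ - F₁) = F₂ - F₁` to the
  -- velocity, which turns `F₁` into `F₂`.
  set H : E → C(Icc a b, E) := fun z => pointwiseApply (Y z) (D z) with hH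
  have hHd : ContDiffAt ℝ 1 H z₀ := by
    have hD1 : ContDiffAt ℝ 1 D z₀ :=
      ((contDiff_one_superposition (restrictTime a b (F := fun t y => F₂ t y - F₁ t y) hΔc)
        (restrictTime a b (F := fun t y => F₂' t y - F₁' t y) hΔc')
        (fun s y => hΔd s y)).contDiffAt).comp z₀ (hΨ.of_le (by norm_num))
    exact ((contDiff_pointwiseApply (K := Icc a b) (E := E) (H := E)).contDiffAt.comp z₀ hY).clm_apply
      hD1
  have hU : ∀ᶠ z in 𝓝 z₀, ContDiffAt ℝ 2 Ψ z ∧ (∀ᶠ z in 𝓝 z, Ψ z - volterra hab.le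
          (superposition (restrictTime a b h₁.continuous) (Ψ z)) = ContinuousMap.const _ z) ∧
        ContDiffAt ℝ 1 Y z :=
    (hΨ.eventually (by simp)).and (hsol.eventually_nhds.and (hY.eventually (by simp)))
  obtain ⟨ε, hε, hεr, hεb, g, hg0, hg⟩ := exists_local_solution_of_contDiffAt hab hHd hU hr
  have hSb : Icc a (a + ε) ⊆ Icc a b := Icc_subset_Icc_right hεb
  have hSr : Icc a (a + ε) ⊆ Icc a (a + r) := Icc_subset_Icc_right (by linarith)
  have ha : a ∈ Icc a (a + ε) := left_mem_Icc.2 (by linarith)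
  set y : ℝ → E := fun t => IccExtend hab.le (Ψ (g t)) t with hy
  set A : ℝ → E →L[ℝ] E := fun t => IccExtend hab.le (Y (g t)) t with hA
  set k : ℝ → E := fun t => IccExtend hab.le (H (g t)) t with hk
  have hkA : ∀ t, k t = A t (F₂ (projIcc a b hab.le t) (y t) - F₁ (projIcc a b hab.le t) (y t)) :=
    fun t => rfl
  have hkA' : ∀ t ∈ Icc a (a + ε), k t = A t (F₂ t (y t) - F₁ t (y t)) := fun t ht => by
    rw [hkA, projIcc_of_mem _ (hSb ht)]
  have hyd : ∀ s ∈ Icc a (a + ε), HasDerivWithinAt y (F₂ s (y s)) (Icc a (a + ε)) s := by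
    intro s hs
    obtain ⟨⟨hΨs, hsols, -⟩, hgs⟩ := hg s hs
    have hinv := h₁.fderiv_apply_inverse hab.le (hΨs.differentiableAt two_ne_zero) hsols
      (hYsol (g s)) ⟨s, hSb hs⟩
    have hV : ContinuousAt (fun z => superposition (restrictTime a b h₁.continuous) (Ψ z)) (g s) :=
      (continuous_superposition _).continuousAt.comp hΨs.continuousAt
    have hgk : HasDerivWithinAt g (k s) (Icc a (a + ε)) s := hgs
    convert hasDerivWithinAt_family_comp hab.le (convex_Icc _ _) hSb hs hgk hsols hV
      (hΨs.differentiableAt two_ne_zero) using 1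
    rw [hkA' s hs]
    simp only [hA, hy, IccExtend_of_mem hab.le _ (hSb hs), hinv]
    simp
  set B : ℝ → E →L[ℝ] E := fun s =>
    negCompRight E (F₁' s (y s)) (A s) + IccExtend hab.le (fderiv ℝ Y (g s) (k s)) s with hB
  have hAd : ∀ s ∈ Icc a (a + ε), HasDerivWithinAt A (B s) (Icc a (a + ε)) s := by
    intro s hs
    obtain ⟨⟨hΨs, hsols, hYs⟩, hgs⟩ := hg s hs
    have hV : ContinuousAt (fun z => pointwiseApply (superposition
        (restrictTime a b (F := fun t y => negCompRight E (F₁' t y)) h₁.continuous_negCompRight)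
          (Ψ z)) (Y z)) (g s) :=
      ((contDiff_pointwiseApply (K := Icc a b) (E := E →L[ℝ] E) (H := E →L[ℝ] E)
        (n := 0)).continuous.continuousAt.comp
        ((continuous_superposition _).continuousAt.comp hΨs.continuousAt)).clm_apply hYs.continuousAt
    have hgk : HasDerivWithinAt g (k s) (Icc a (a + ε)) s := hgs
    have key := hasDerivWithinAt_family_comp (c := fun _ => 1) hab.le (convex_Icc _ _) hSb hs hgk
      (Eventually.of_forall hYsol) hV (hYs.differentiableAt one_ne_zero)
    have e : B s = pointwiseApply (superposition (restrictTime a b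
        (F := fun t y => negCompRight E (F₁' t y)) h₁.continuous_negCompRight) (Ψ (g s))) (Y (g s))
          ⟨s, hSb hs⟩ + fderiv ℝ Y (g s) (k s) ⟨s, hSb hs⟩ := by
      simp only [hB, hA, hy, IccExtend_of_mem hab.le _ (hSb hs)]
      rfl
    rw [e]
    exact key
  -- Only the difference of the modes is differentiated in time.
  have hδd : ∀ s ∈ Icc a (a + ε), HasDerivWithinAt (fun t => F₂ t (y t) - F₁ t (y t))
      (d s (y s) + (F₂' s (y s) - F₁' s (y s)) (F₂ s (y s))) (Icc a (a + ε)) s := fun s hs =>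
    hasDerivWithinAt_of_partial (f := fun t z => F₂ t z - F₁ t z) (convex_Icc _ _) hs
      (Eventually.of_forall fun z t ht => (hd t (hSr ht) z).mono hSr)
      ((hdc (s, y s) ⟨hSr hs, mem_univ _⟩).mono (prod_mono_left hSr)) (hΔd s _) (hyd s hs)
  set k' : ℝ → E := fun s => B s (F₂ s (y s) - F₁ s (y s))
    + A s (d s (y s) + (F₂' s (y s) - F₁' s (y s)) (F₂ s (y s))) with hk'
  have hkd : ∀ s ∈ Icc a (a + ε), HasDerivWithinAt k (k' s) (Icc a (a + ε)) s := fun s hs =>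
    ((hAd s hs).clm_apply (hδd s hs)).congr hkA' (hkA' s hs)
  have hyc : ContinuousOn y (Icc a (a + ε)) := fun s hs => (hyd s hs).continuousWithinAt
  have hyc' : ContinuousOn (fun s => (s, y s)) (Icc a (a + ε)) := continuousOn_id.prodMk hyc
  have hAc : ContinuousOn A (Icc a (a + ε)) := fun s hs => (hAd s hs).continuousWithinAt
  have hBc : ContinuousOn B (Icc a (a + ε)) := by
    refine ContinuousOn.add (((negCompRight E).continuous.comp_continuousOn
      (h₁.continuous'.comp_continuousOn hyc')).clm_apply hAc) fun s hs => ?_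
    refine continuousWithinAt_IccExtend_apply hab.le ?_
    obtain ⟨⟨-, -, hYs⟩, hgs⟩ := hg s hs
    exact (((hYs.fderiv_right (m := 0) (by norm_num)).continuousAt).comp_continuousWithinAt
      hgs.continuousWithinAt).clm_apply (hkd s hs).continuousWithinAt
  have hk'c : ContinuousOn k' (Icc a (a + ε)) :=
    (hBc.clm_apply (hΔc.comp_continuousOn hyc')).add (hAc.clm_apply
      ((hdc.comp hyc' fun s hs => ⟨hSr hs, mem_univ _⟩).add
        ((hΔc'.comp_continuousOn hyc').clm_apply (h₂.continuous.comp_continuousOn hyc'))))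
  have hya : y a = z₀ := by
    simp only [hy, IccExtend_of_mem hab.le _ (hSb ha), hg0]
    exact apply_left_of_sub_volterra_eq_const hab.le hsol.self_of_nhds
  have hAa : A a = 1 := by
    simp only [hA, IccExtend_of_mem hab.le _ (hSb ha)]
    exact apply_left_of_sub_volterra_eq_const hab.le (hYsol _)
  -- At time `a`, `Y z` is the identity for every `z`, so `k' a` receives from `Y` only `-F₁' (F₂ -
  -- F₁)`.
  have hYa : ∀ e, fderiv ℝ Y z₀ e ⟨a, hSb ha⟩ = 0 := by
    intro e
    have h3 := (ContinuousMap.evalCLM ℝ (⟨a, hSb ha⟩ : Icc a b) (M := E →L[ℝ] E)).hasFDerivAt.comp z₀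
      (hY.differentiableAt one_ne_zero).hasFDerivAt
    have h4 : HasFDerivAt (fun z => Y z ⟨a, hSb ha⟩) (0 : E →L[ℝ] (E →L[ℝ] E)) z₀ := by
      have : (fun z => Y z ⟨a, hSb ha⟩) = fun _ => 1 := funext fun z =>
        apply_left_of_sub_volterra_eq_const hab.le (hYsol z)
      rw [this]
      exact hasFDerivAt_const _ _
    exact DFunLike.congr_fun (h3.unique h4) e
  refine ⟨ε, hε, hεr, hεb, Ψ, g, k, k', hΨx, hg0, ?_, ?_, hk'c, fun s hs =>
    ⟨(hg s hs).1.1, (hg s hs).1.2.1, (hg s hs).2, hkd s hs, hyd s hs⟩⟩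
  · rw [hkA' a ha, hAa, hya]
    rfl
  · simp only [hk', hB, hAa, hya, hg0, IccExtend_of_mem hab.le _ (hSb ha), hYa]
    simp [two_smul]
    abel

end Insertion

/-! ### Second derivative of a terminal cost. -/

section Mayer

variable {a b : ℝ} {E : Type*} [NormedAddCommGroup E] [NormedSpace ℝ E] [FiniteDimensional ℝ E]
  {F₁ F₂ : ℝ → E → E} {F₁' F₂' : ℝ → E → E →L[ℝ] E} {F₁'' F₂'' : ℝ → E → E →L[ℝ] E →L[ℝ] E}

/-- Mode insertion for a terminal cost: the trajectories, the twice differentiable dependence of the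
cost on the duration, and the second derivative at `0` in terms of the variational equations. -/
theorem exists_insertion_terminal_cost (h₁ : IsC2Field F₁ F₁' F₁'') (h₂ : IsC2Field F₂ F₂' F₂'')
    (hab : a < b) {r : ℝ} (hr : 0 < r) {d : ℝ → E → E}
    (hd : ∀ t ∈ Icc a (a + r), ∀ y,
      HasDerivWithinAt (fun s => F₂ s y - F₁ s y) (d t y) (Icc a (a + r)) t)
    (hdc : ContinuousOn (fun p : ℝ × E => d p.1 p.2) (Icc a (a + r) ×ˢ univ))
    {M : E → ℝ} (hM : Differentiable ℝ M) (hM' : Differentiable ℝ (fderiv ℝ M))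
    {x : ℝ → E} (hxc : ContinuousOn x (Icc a b))
    (hx : ∀ t ∈ Ico a b, HasDerivWithinAt x (F₁ t (x t)) (Ici t) t) :
    ∃ ε, 0 < ε ∧ a + ε ≤ b ∧ ∃ (Z : ℝ → ℝ → E) (J₁ J₂ : ℝ → ℝ),
      (∀ lam ∈ Icc 0 ε, Z lam a = x a ∧ ContinuousOn (Z lam) (Icc a b) ∧
        (∀ t ∈ Ico a (a + lam), HasDerivWithinAt (Z lam) (F₂ t (Z lam t)) (Ici t) t) ∧
        ∀ t ∈ Ico (a + lam) b, HasDerivWithinAt (Z lam) (F₁ t (Z lam t)) (Ici t) t) ∧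
      (∀ lam ∈ Icc 0 ε, HasDerivWithinAt (fun s => M (Z s b)) (J₁ lam) (Icc 0 ε) lam ∧
        HasDerivWithinAt J₁ (J₂ lam) (Icc 0 ε) lam) ∧
      (ContDiff ℝ 2 M → ContinuousWithinAt J₂ (Icc 0 ε) 0) ∧
      ∃ (P : E →L[ℝ] ℝ) (Q : ℝ),
        J₂ 0 = Q + P (d a (x a) + F₂' a (x a) (F₂ a (x a)) + F₁' a (x a) (F₁ a (x a))
          - (2 : ℝ) • F₁' a (x a) (F₂ a (x a))) ∧
        (∀ e, ∃ v : ℝ → E, v a = e ∧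
          (∀ t ∈ Icc a b, HasDerivWithinAt v (F₁' t (x t) (v t)) (Icc a b) t) ∧
          P e = fderiv ℝ M (x b) (v b)) ∧
        ∃ v w : ℝ → E, v a = F₂ a (x a) - F₁ a (x a) ∧ w a = 0 ∧
          (∀ t ∈ Icc a b, HasDerivWithinAt v (F₁' t (x t) (v t)) (Icc a b) t) ∧
          (∀ t ∈ Icc a b, HasDerivWithinAt w (F₁' t (x t) (w t) + F₁'' t (x t) (v t) (v t))
            (Icc a b) t) ∧
          Q = fderiv ℝ (fderiv ℝ M) (x b) (v b) (v b) + fderiv ℝ M (x b) (w b) := by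
  have : CompleteSpace E := FiniteDimensional.complete ℝ E
  set xc : C(Icc a b, E) := ⟨fun t => x t, hxc.domRestrict⟩ with hxcdef
  have hxe : ∀ t ∈ Icc a b, IccExtend hab.le xc t = x t := fun t ht => by
    rw [IccExtend_of_mem hab.le _ ht]; rfl
  have hx0 : xc - volterra hab.le (superposition (restrictTime a b h₁.continuous) xc)
      = ContinuousMap.const _ (x a) := by
    refine sub_volterra_eq_const (u := xc) hab.le fun t ht => ?_
    refine ((hx t ht).mono_of_mem_nhdsWithin (t := Ici t) self_mem_nhdsWithin).congr_of_eventuallyEq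
      ?_ (hxe t (Ico_subset_Icc_self ht))
    filter_upwards [Icc_mem_nhdsGE_of_mem ht] with s hs using hxe s hs
  obtain ⟨ε, hε, -, hεb, Ψ, g, k, k', hΨx, hga, hka, hk'a, hk'c, hcurve⟩ :=
    exists_insertion_curve h₁ h₂ hab hr hd hdc hx0
  have haS : a ∈ Icc a (a + ε) := left_mem_Icc.2 (by linarith)
  have hSb : Icc a (a + ε) ⊆ Icc a b := Icc_subset_Icc_right hεb
  have haK : a ∈ Icc a b := left_mem_Icc.2 hab.le
  have hbK : b ∈ Icc a b := right_mem_Icc.2 hab.le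
  obtain ⟨hΨ0, hsol0, -, -, -⟩ := hcurve a haS
  rw [hga] at hΨ0 hsol0
  set ev : C(Icc a b, E) →L[ℝ] E := ContinuousMap.evalCLM ℝ (⟨b, hbK⟩ : Icc a b) with hev
  set ψ : E → E := fun z => ev (Ψ z) with hψ
  set ψ' : E → E →L[ℝ] E := fun z => ev ∘L fderiv ℝ Ψ z with hψ'
  set W₁ : E → E →L[ℝ] ℝ := fun z => fderiv ℝ M (ψ z) ∘L ψ' z with hW₁
  have hψd : ∀ {z}, ContDiffAt ℝ 2 Ψ z → HasFDerivAt ψ (ψ' z) z := fun hz =>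
    ev.hasFDerivAt.comp _ (hz.differentiableAt two_ne_zero).hasFDerivAt
  have hψd' : ∀ {z}, ContDiffAt ℝ 2 Ψ z →
      HasFDerivAt ψ' (ContinuousLinearMap.compL ℝ E _ E ev ∘L fderiv ℝ (fderiv ℝ Ψ) z) z := fun hz =>
    ((hasFDerivAt_const ev _).clm_comp ((hz.fderiv_right (m := 1)
      (by norm_num)).differentiableAt one_ne_zero).hasFDerivAt).congr_fderiv (by simp)
  have hWd : ∀ {z}, ContDiffAt ℝ 2 Ψ z → HasFDerivAt (fun z => M (ψ z)) (W₁ z) z := fun hz =>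
    (hM _).hasFDerivAt.comp _ (hψd hz)
  have hW₁d : ∀ {z}, ContDiffAt ℝ 2 Ψ z → DifferentiableAt ℝ W₁ z := fun hz =>
    (((hM' _).hasFDerivAt.comp _ (hψd hz)).clm_comp (hψd' hz)).differentiableAt
  have hshift : ∀ {lam}, lam ∈ Icc 0 ε → a + lam ∈ Icc a (a + ε) := fun hl =>
    ⟨by linarith [hl.1], by linarith [hl.2]⟩
  have hsd : ∀ lam, HasDerivWithinAt (fun s => a + s) 1 (Icc 0 ε) lam := fun lam =>
    ((hasDerivAt_id lam).const_add a).hasDerivWithinAt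
  have hmaps : MapsTo (fun s => a + s) (Icc 0 ε) (Icc a (a + ε)) := fun _ hs => hshift hs
  -- The minimum freezes the parameter at time `a + lam`; from then on the curve is a solution of
  -- the first mode.
  set Z : ℝ → ℝ → E := fun lam t => IccExtend hab.le (Ψ (g (min t (a + lam)))) t with hZ
  have hZb : ∀ lam ∈ Icc 0 ε, M (Z lam b) = M (ψ (g (a + lam))) := fun lam hl => by
    have : a + lam ≤ b := (hSb (hshift hl)).2
    simp only [hZ, min_eq_right this, IccExtend_of_mem hab.le _ hbK]
    rfl
  -- `W₁` is the derivative of `z ↦ M (ψ z)`, so `J₁` and `J₂` are the chain and product rules along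
  -- `g`, with `g' = k` and `k' = g''`.
  refine ⟨ε, hε, hεb, Z, fun lam => W₁ (g (a + lam)) (k (a + lam)),
    fun lam => fderiv ℝ W₁ (g (a + lam)) (k (a + lam)) (k (a + lam))
      + W₁ (g (a + lam)) (k' (a + lam)), fun lam hl => ⟨?_, ?_, ?_, ?_⟩, fun lam hl => ⟨?_, ?_⟩,
      fun hM2 => ?_, W₁ (x a), fderiv ℝ W₁ (x a) (k a) (k a), ?_, fun e => ?_, ?_⟩
  · have : min a (a + lam) = a := min_eq_left (by linarith [hl.1])
    simp only [hZ, this, IccExtend_of_mem hab.le _ haK, hga, hΨx]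
    rfl
  · intro t ht
    have hmin : ContinuousOn (fun t => g (min t (a + lam))) (Icc a b) := by
      refine ContinuousOn.comp (t := Icc a (a + ε)) (fun s hs => (hcurve s hs).2.2.1.continuousWithinAt)
        (by fun_prop) fun t ht => ⟨le_min ht.1 (by linarith [hl.1]), ?_⟩
      exact (min_le_right _ _).trans (by linarith [hl.2])
    have hmem : min t (a + lam) ∈ Icc a (a + ε) :=
      ⟨le_min ht.1 (by linarith [hl.1]), (min_le_right _ _).trans (by linarith [hl.2])⟩
    exact continuousWithinAt_IccExtend_apply hab.le (ContinuousAt.comp_continuousWithinAt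
      (f := fun t => g (min t (a + lam))) (hcurve _ hmem).1.continuousAt (hmin t ht))
  · intro t ht
    have htS : t ∈ Icc a (a + ε) := ⟨ht.1, by linarith [ht.2, hl.2]⟩
    have h5 := (hcurve t htS).2.2.2.2
    have hZt : ∀ s < a + lam, Z lam s = IccExtend hab.le (Ψ (g s)) s := fun s hs => by
      simp only [hZ, min_eq_left hs.le]
    rw [hZt t ht.2]
    refine (h5.mono_of_mem_nhdsWithin (Icc_mem_nhdsGE_of_mem
      ⟨ht.1, by linarith [ht.2, hl.2]⟩)).congr_of_eventuallyEq ?_ (hZt t ht.2)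
    filter_upwards [mem_nhdsWithin_of_mem_nhds (Iio_mem_nhds ht.2)] with s hs using hZt s hs
  · intro t ht
    have htK : t ∈ Ico a b := ⟨by linarith [ht.1, hl.1], ht.2⟩
    have hZt : ∀ s ∈ Ici t, Z lam s = IccExtend hab.le (Ψ (g (a + lam))) s := fun s hs => by
      have : a + lam ≤ s := ht.1.trans hs
      simp only [hZ, min_eq_right this]
    have h5 := hasDerivWithinAt_of_sub_volterra_eq_const hab.le
      (hcurve _ (hshift hl)).2.1.self_of_nhds (Ico_subset_Icc_self htK)
    rw [superposition_apply, restrictTime_apply] at h5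
    have h6 : Z lam t = Ψ (g (a + lam)) ⟨t, Ico_subset_Icc_self htK⟩ := by
      rw [hZt t self_mem_Ici, IccExtend_of_mem hab.le _ (Ico_subset_Icc_self htK)]
    rw [h6]
    exact (h5.mono_of_mem_nhdsWithin (Icc_mem_nhdsGE_of_mem htK)).congr hZt (hZt t self_mem_Ici)
  · obtain ⟨hz, -, hg, -, -⟩ := hcurve _ (hshift hl)
    have := ((hWd hz).comp_hasDerivWithinAt (a + lam) hg).scomp lam (hsd lam) hmaps
    rw [one_smul] at this
    exact this.congr hZb (hZb lam hl)
  · obtain ⟨hz, -, hg, hk, -⟩ := hcurve _ (hshift hl)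
    have := (((hW₁d hz).hasFDerivAt.comp_hasDerivWithinAt (a + lam) hg).clm_apply hk).scomp lam
      (hsd lam) hmaps
    rw [one_smul] at this
    exact this
  -- For `M` of class `C²` the map `W₁` is `C¹`; without this it is differentiable but its
  -- derivative may fail to be continuous.
  · obtain ⟨hz, -, hg, hk, -⟩ := hcurve a haS
    have hW₁1 : ContDiffAt ℝ 1 W₁ (g a) := by
      refine ContDiffAt.clm_comp ?_ ?_
      · exact (hM2.contDiffAt.fderiv_right (m := 1) (by norm_num)).comp _
          (ev.contDiff.contDiffAt.comp _ (hz.of_le (by norm_num)))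
      · exact contDiffAt_const.clm_comp (hz.fderiv_right (m := 1) (by norm_num))
    have hW₂c : ContinuousWithinAt (fun s => fderiv ℝ W₁ (g s)) (Icc a (a + ε)) a :=
      (hW₁1.fderiv_right (m := 0) (by norm_num)).continuousAt.comp_continuousWithinAt
        hg.continuousWithinAt
    have hc : ContinuousWithinAt (fun s => fderiv ℝ W₁ (g s) (k s) (k s) + W₁ (g s) (k' s))
        (Icc a (a + ε)) a :=
      ((hW₂c.clm_apply hk.continuousWithinAt).clm_apply hk.continuousWithinAt).add
        ((hW₁1.continuousAt.comp_continuousWithinAt hg.continuousWithinAt).clm_apply (hk'c a haS))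
    have hs0 := (hsd 0).continuousWithinAt
    refine ContinuousWithinAt.comp (f := fun s => a + s) (t := Icc a (a + ε))
      (g := fun s => fderiv ℝ W₁ (g s) (k s) (k s) + W₁ (g s) (k' s)) ?_ hs0 hmaps
    rw [add_zero]
    exact hc
  · simp only [add_zero, hga, hk'a]
  · have hv := h₁.fderiv_solutionFamily hab.le (hΨ0.differentiableAt two_ne_zero) hsol0 e
    refine ⟨IccExtend hab.le (fderiv ℝ Ψ (x a) e), ?_, fun t ht => ?_, ?_⟩
    · rw [IccExtend_of_mem hab.le _ haK]
      exact apply_left_of_sub_volterra_eq_const hab.le hv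
    · have := hasDerivWithinAt_of_sub_volterra_eq_const hab.le hv ht
      rw [hΨx] at this
      rw [IccExtend_of_mem hab.le _ ht]
      exact this
    · rw [IccExtend_of_mem hab.le _ hbK]
      have : ψ (x a) = x b := by simp only [hψ, hΨx]; rfl
      simp only [hW₁, this]
      rfl
  · have hv := h₁.fderiv_solutionFamily hab.le (hΨ0.differentiableAt two_ne_zero) hsol0 (k a)
    have hw := h₁.fderiv_fderiv_solutionFamily hab.le hΨ0 hsol0 (k a)
    refine ⟨IccExtend hab.le (fderiv ℝ Ψ (x a) (k a)),
      IccExtend hab.le (fderiv ℝ (fderiv ℝ Ψ) (x a) (k a) (k a)), ?_, ?_, fun t ht => ?_,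
      fun t ht => ?_, ?_⟩
    · rw [IccExtend_of_mem hab.le _ haK, ← hka]
      exact apply_left_of_sub_volterra_eq_const hab.le hv
    · rw [IccExtend_of_mem hab.le _ haK]
      exact apply_left_of_sub_volterra_eq_const hab.le hw
    · have := hasDerivWithinAt_of_sub_volterra_eq_const hab.le hv ht
      rw [hΨx] at this
      rw [IccExtend_of_mem hab.le _ ht]
      exact this
    · have := hasDerivWithinAt_of_sub_volterra_eq_const hab.le hw ht
      rw [hΨx] at this
      rw [IccExtend_of_mem hab.le _ ht, IccExtend_of_mem hab.le _ ht]
      exact this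
    · rw [IccExtend_of_mem hab.le _ hbK, IccExtend_of_mem hab.le _ hbK]
      have hb : ψ (x a) = x b := by simp only [hψ, hΨx]; rfl
      have := fderiv_terminal hM' (hψd hΨ0) (hψd' hΨ0) (k a)
      rw [hb] at this
      exact this

end Mayer

/-! ### Linear differential equations with initial or terminal data. -/

section LinearODE

variable {a b : ℝ} {E : Type*} [NormedAddCommGroup E] [NormedSpace ℝ E]

theorem exists_linear_ode_initial [CompleteSpace E] (h : a ≤ b) {A : ℝ → E →L[ℝ] E} {c : ℝ → E}
    (hA : ContinuousOn A (Icc a b)) (hc : ContinuousOn c (Icc a b)) (y₀ : E) :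
    ∃ u : ℝ → E, u a = y₀ ∧
      ∀ t ∈ Icc a b, HasDerivWithinAt u (A t (u t) + c t) (Icc a b) t := by
  set Ac : C(Icc a b, E →L[ℝ] E) := ⟨fun t => A t, hA.domRestrict⟩
  set cc : C(Icc a b, E) := ⟨fun t => c t, hc.domRestrict⟩
  obtain ⟨U, hU⟩ := isUnit_one_sub_volterra_comp h Ac
  set u : C(Icc a b, E) := (U⁻¹ : (C(Icc a b, E) →L[ℝ] C(Icc a b, E))ˣ).1
    (ContinuousMap.const _ y₀ + volterra h cc)
  have hu : (1 - volterra h ∘L pointwiseApply Ac) u = ContinuousMap.const _ y₀ + volterra h cc := by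
    rw [← hU]
    exact DFunLike.congr_fun U.mul_inv _
  have hu' : u - volterra h (pointwiseApply Ac u + cc) = ContinuousMap.const _ y₀ := by
    rw [map_add, ← sub_sub, sub_eq_iff_eq_add]
    exact hu
  refine ⟨IccExtend h u, ?_, fun t ht => ?_⟩
  · rw [IccExtend_of_mem h _ (left_mem_Icc.2 h)]
    exact apply_left_of_sub_volterra_eq_const h hu'
  · rw [IccExtend_of_mem h _ ht]
    exact hasDerivWithinAt_of_sub_volterra_eq_const h hu' ht

/-- The reflection `t ↦ a + b - t` exchanges terminal and initial data. In finite dimension,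
pointwise continuity of `A` gives continuity in operator norm. -/
theorem exists_linear_ode_terminal [FiniteDimensional ℝ E] (h : a ≤ b) {A : ℝ → E →ₗ[ℝ] E}
    {c : ℝ → E} (hA : ∀ y, ContinuousOn (fun t => A t y) (Icc a b)) (hc : ContinuousOn c (Icc a b))
    (y₀ : E) :
    ∃ u : ℝ → E, u b = y₀ ∧
      ∀ t ∈ Icc a b, HasDerivWithinAt u (A t (u t) + c t) (Icc a b) t := by
  have : CompleteSpace E := FiniteDimensional.complete ℝ E
  have hr : MapsTo (fun t => a + b - t) (Icc a b) (Icc a b) := fun t ht =>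
    ⟨by linarith [ht.2], by linarith [ht.1]⟩
  have hrc : ContinuousOn (fun t => a + b - t) (Icc a b) := by fun_prop
  obtain ⟨u, hu, hu'⟩ := exists_linear_ode_initial h
    (A := fun t => -LinearMap.toContinuousLinearMap (A (a + b - t))) (c := fun t => -c (a + b - t))
    (continuousOn_clm_apply.2 fun y => ((hA y).comp hrc hr).neg) (hc.comp hrc hr).neg y₀
  refine ⟨fun t => u (a + b - t), by simpa using hu, fun t ht => ?_⟩
  have h1 := (hu' _ (hr ht)).scomp t ((hasDerivAt_id t).const_sub (a + b)).hasDerivWithinAt hr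
  exact h1.congr_deriv (by simp)

/-- The integral of a function that is continuous on `[a, b]`. -/
theorem hasDerivWithinAt_integral_Icc [CompleteSpace E] {u : ℝ → E} (hu : ContinuousOn u (Icc a b))
    {t : ℝ} (ht : t ∈ Icc a b) :
    HasDerivWithinAt (fun t => ∫ s in a..t, u s) (u t) (Icc a b) t := by
  have h : a ≤ b := ht.1.trans ht.2
  have hw : Continuous (IccExtend h fun s : Icc a b => u s) := hu.domRestrict.Icc_extend'
  have h1 := (hw.integral_hasStrictDerivAt a t).hasDerivAt.hasDerivWithinAt (s := Icc a b)
  rw [IccExtend_of_mem h _ ht] at h1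
  have key : ∀ s ∈ Icc a b, ∫ r in a..s, u r = ∫ r in a..s, IccExtend h (fun s : Icc a b => u s) r := by
    intro s hs
    refine intervalIntegral.integral_congr fun r hr => ?_
    rw [uIcc_of_le hs.1] at hr
    exact (IccExtend_of_mem h (fun s : Icc a b => u s) ⟨hr.1, hr.2.trans hs.2⟩).symm
  exact h1.congr key (key t ht)

end LinearODE

/-! ### Matrices versus Fréchet derivatives. -/

section Coordinates

variable {N : ℕ}

theorem fderiv_eq_sum_single {G : Type*} [NormedAddCommGroup G] [NormedSpace ℝ G]
    (L : (Fin N → ℝ) →L[ℝ] G) (e : Fin N → ℝ) : L e = ∑ i, e i • L (Pi.single i 1) := by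
  conv_lhs => rw [pi_eq_sum_univ' e]
  simp

theorem gradVec_dotProduct (φ : (Fin N → ℝ) → ℝ) (y e : Fin N → ℝ) :
    gradVec φ y ⬝ᵥ e = fderiv ℝ φ y e := by
  rw [fderiv_eq_sum_single (fderiv ℝ φ y) e]
  simp [gradVec, dotProduct, mul_comm]

theorem jacobianMatrix_mulVec (F : (Fin N → ℝ) → (Fin N → ℝ)) (y e : Fin N → ℝ) :
    jacobianMatrix F y *ᵥ e = fderiv ℝ F y e := by
  ext i
  rw [fderiv_eq_sum_single (fderiv ℝ F y) e]
  simp [jacobianMatrix, Matrix.mulVec, dotProduct, mul_comm]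

theorem hessianMatrix_apply {φ : (Fin N → ℝ) → ℝ} {y : Fin N → ℝ}
    (hφ : DifferentiableAt ℝ (fderiv ℝ φ) y) (i j : Fin N) :
    hessianMatrix φ y i j = fderiv ℝ (fderiv ℝ φ) y (Pi.single i 1) (Pi.single j 1) := by
  have h1 : HasFDerivAt (fun z => fderiv ℝ φ z (Pi.single j 1))
      ((fderiv ℝ (fderiv ℝ φ) y).flip (Pi.single j 1)) y :=
    (hφ.hasFDerivAt.clm_apply (hasFDerivAt_const _ y)).congr_fderiv (by ext1; simp)
  simp only [hessianMatrix, Matrix.of_apply]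
  rw [h1.fderiv]
  rfl

theorem dotProduct_hessianMatrix_mulVec {φ : (Fin N → ℝ) → ℝ} {y : Fin N → ℝ}
    (hφ : DifferentiableAt ℝ (fderiv ℝ φ) y) (e e' : Fin N → ℝ) :
    e ⬝ᵥ (hessianMatrix φ y *ᵥ e') = fderiv ℝ (fderiv ℝ φ) y e e' := by
  rw [fderiv_eq_sum_single (fderiv ℝ (fderiv ℝ φ) y) e]
  simp only [dotProduct, Matrix.mulVec, hessianMatrix_apply hφ, _root_.sum_apply,
    _root_.smul_apply, smul_eq_mul]
  refine Finset.sum_congr rfl fun i _ => ?_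
  rw [fderiv_eq_sum_single (fderiv ℝ (fderiv ℝ φ) y (Pi.single i 1)) e']
  simp [mul_comm]

theorem fderiv_fderiv_component {F : (Fin N → ℝ) → (Fin N → ℝ)} (hF : ContDiff ℝ 2 F)
    (y e e' : Fin N → ℝ) (k : Fin N) :
    fderiv ℝ (fderiv ℝ fun z => F z k) y e e' = fderiv ℝ (fderiv ℝ F) y e e' k := by
  have h0 : fderiv ℝ (fun z => F z k) = fun z => ContinuousLinearMap.proj k ∘L fderiv ℝ F z := by
    ext1 z
    exact ((ContinuousLinearMap.proj (R := ℝ) (φ := fun _ : Fin N => ℝ) k).hasFDerivAt.comp z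
      (hF.differentiable two_ne_zero z).hasFDerivAt).fderiv
  have h1 := (hasFDerivAt_const (𝕜 := ℝ) (ContinuousLinearMap.proj (R := ℝ) (φ := fun _ : Fin N => ℝ) k)
    y).clm_comp ((hF.fderiv_right (m := 1) (by norm_num)).differentiable one_ne_zero y).hasFDerivAt
  rw [h0, h1.fderiv]
  simp

theorem differentiable_fderiv_of_contDiff_two {V G : Type*} [NormedAddCommGroup V] [NormedSpace ℝ V]
    [NormedAddCommGroup G] [NormedSpace ℝ G] {φ : V → G} (hφ : ContDiff ℝ 2 φ) :
    Differentiable ℝ (fderiv ℝ φ) :=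
  (hφ.fderiv_right (m := 1) (by norm_num)).differentiable one_ne_zero

end Coordinates

/-! ### Existence of the adjoints. -/

section Adjoints

variable {N : ℕ} {f₁ : ℝ → (Fin N → ℝ) → (Fin N → ℝ)} {l m : (Fin N → ℝ) → ℝ} {t₀ tf : ℝ}
  {x : ℝ → (Fin N → ℝ)}

theorem continuousOn_jacobianMatrix (hf₁ : IsC2Mode f₁) (hx : ContinuousOn x (Icc t₀ tf))
    (i j : Fin N) : ContinuousOn (fun t => jacobianMatrix (f₁ t) (x t) i j) (Icc t₀ tf) :=
  continuousOn_pi.1 ((hf₁.continuous_fderiv.comp_continuousOn (continuousOn_id.prodMk hx)).clm_apply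
    continuousOn_const) i

theorem continuousOn_hessianMatrix {φ : ℝ → (Fin N → ℝ) → ℝ} (hφ : ∀ t, ContDiff ℝ 2 (φ t))
    (hφ' : Continuous fun p : ℝ × (Fin N → ℝ) => fderiv ℝ (fderiv ℝ (φ p.1)) p.2)
    (hx : ContinuousOn x (Icc t₀ tf)) (i j : Fin N) :
    ContinuousOn (fun t => hessianMatrix (φ t) (x t) i j) (Icc t₀ tf) := by
  simp_rw [fun t => hessianMatrix_apply (differentiable_fderiv_of_contDiff_two (hφ t) (x t)) i j]
  exact ((hφ'.comp_continuousOn (continuousOn_id.prodMk hx)).clm_apply continuousOn_const).clm_apply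
    continuousOn_const

theorem exists_isFirstAdjoint (hf₁ : IsC2Mode f₁) (hl : ContDiff ℝ 2 l) (h : t₀ ≤ tf)
    (hx : ContinuousOn x (Icc t₀ tf)) : ∃ ρ, IsFirstAdjoint f₁ l m t₀ tf x ρ := by
  have hJ := continuousOn_jacobianMatrix hf₁ hx
  obtain ⟨ρ, hρ, hρ'⟩ := exists_linear_ode_terminal h
    (A := fun t => -(jacobianMatrix (f₁ t) (x t))ᵀ.mulVecLin) (c := fun t => -gradVec l (x t))
    (fun y => by
      refine ContinuousOn.neg (f := fun t => (jacobianMatrix (f₁ t) (x t))ᵀ *ᵥ y) ?_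
      refine continuousOn_pi.2 fun i => ?_
      simp only [Matrix.mulVec, dotProduct, Matrix.transpose_apply]
      exact continuousOn_finsetSum _ fun j _ => (hJ j i).mul continuousOn_const)
    (by
      refine ContinuousOn.neg (continuousOn_pi.2 fun i => ?_)
      exact ((hl.continuous_fderiv (by norm_num)).comp_continuousOn hx).clm_apply continuousOn_const)
    (gradVec m (x tf))
  refine ⟨ρ, hρ, fun t ht => ?_⟩
  refine (hρ' t ht).congr_deriv ?_
  simp only [LinearMap.neg_apply, Matrix.mulVecLin_apply]
  abel

/-- The linear operator `Y ↦ -Jᵀ Y - Y J`. -/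
def lyapunovMap (J : Matrix (Fin N) (Fin N) ℝ) : (Fin N → Fin N → ℝ) →ₗ[ℝ] (Fin N → Fin N → ℝ) where
  toFun Y i j := -(∑ k, J k i * Y k j) - ∑ k, Y i k * J k j
  map_add' Y Y' := by
    ext i j
    simp only [Pi.add_apply, mul_add, add_mul, Finset.sum_add_distrib]
    ring
  map_smul' c Y := by
    ext i j
    simp only [Pi.smul_apply, smul_eq_mul, RingHom.id_apply, mul_sub, mul_neg, Finset.mul_sum]
    congr 2
    · exact Finset.sum_congr rfl fun k _ => by ring
    · ext k; ring

theorem lyapunovMap_apply (J : Matrix (Fin N) (Fin N) ℝ) (Y : Fin N → Fin N → ℝ) (i j : Fin N) :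
    lyapunovMap J Y i j = -(∑ k, J k i * Y k j) - ∑ k, Y i k * J k j := rfl

theorem exists_isSecondAdjoint (hf₁ : IsC2Mode f₁) (hl : ContDiff ℝ 2 l) (h : t₀ ≤ tf)
    (hx : ContinuousOn x (Icc t₀ tf)) {ρ : ℝ → (Fin N → ℝ)} (hρ : ContinuousOn ρ (Icc t₀ tf)) :
    ∃ Ω, IsSecondAdjoint f₁ l m t₀ tf x ρ Ω := by
  have hJ := continuousOn_jacobianMatrix hf₁ hx
  obtain ⟨Ω, hΩ, hΩ'⟩ := exists_linear_ode_terminal (E := Fin N → Fin N → ℝ) h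
    (A := fun t => lyapunovMap (jacobianMatrix (f₁ t) (x t)))
    (c := fun t => -hessianMatrix l (x t)
        - ∑ k : Fin N, ρ t k • hessianMatrix (fun y => f₁ t y k) (x t))
    (fun Y => by
      refine continuousOn_pi.2 fun i => continuousOn_pi.2 fun j => ?_
      simp only [lyapunovMap_apply]
      exact (continuousOn_finsetSum _ fun k _ => (hJ k i).mul continuousOn_const).neg.sub
        (continuousOn_finsetSum _ fun k _ => continuousOn_const.mul (hJ k j)))
    (by
      refine continuousOn_pi.2 fun i => continuousOn_pi.2 fun j => ?_
      simp only [Matrix.sub_apply, Matrix.neg_apply, Matrix.sum_apply, Matrix.smul_apply]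
      refine (continuousOn_hessianMatrix (fun _ => hl) (((hl.fderiv_right (m := 1)
        (by norm_num)).continuous_fderiv (by norm_num)).comp continuous_snd) hx i j).neg.sub
        (continuousOn_finsetSum _ fun k _ => (continuousOn_pi.1 hρ k).smul ?_)
      have hk : ∀ t, ContDiff ℝ 2 fun y => f₁ t y k := fun t => contDiff_pi.1 (hf₁.contDiff t) k
      refine continuousOn_hessianMatrix (φ := fun t y => f₁ t y k) hk ?_ hx i j
      refine continuous_clm_apply.2 fun e => continuous_clm_apply.2 fun e' => ?_
      simp_rw [fun p : ℝ × (Fin N → ℝ) => fderiv_fderiv_component (hf₁.contDiff p.1) p.2 e e' k]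
      exact (continuous_pi_iff.1 ((hf₁.continuous_fderiv2.clm_apply
        continuous_const).clm_apply continuous_const)) k)
    (hessianMatrix m (x tf))ᵀ
  refine ⟨fun t => Matrix.of (Ω t), hΩ, fun t ht i j => ?_⟩
  have := hasDerivWithinAt_pi.1 (hasDerivWithinAt_pi.1 (hΩ' t ht) i) j
  refine this.congr_deriv ?_
  change lyapunovMap (jacobianMatrix (f₁ t) (x t)) (Ω t) i j + (-hessianMatrix l (x t)
    - ∑ k : Fin N, ρ t k • hessianMatrix (fun y => f₁ t y k) (x t)) i j = _
  simp only [lyapunovMap_apply, Matrix.sub_apply, Matrix.neg_apply, Matrix.mul_apply,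
    Matrix.transpose_apply, Matrix.of_apply]
  ring

end Adjoints

/-! ### Uniqueness of switched trajectories. -/

section Uniqueness

variable {N : ℕ} {f₁ f₂ : ℝ → (Fin N → ℝ) → (Fin N → ℝ)}

theorem IsC2Mode.exists_lipschitzOnWith {f : ℝ → (Fin N → ℝ) → (Fin N → ℝ)} (hf : IsC2Mode f)
    (t₀ tf R : ℝ) :
    ∃ K, ∀ t ∈ Icc t₀ tf, LipschitzOnWith K (f t) (Metric.closedBall 0 R) := by
  obtain ⟨C, hC⟩ := (isCompact_Icc.prod (isCompact_closedBall (0 : Fin N → ℝ) R)).exists_bound_of_continuousOn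
    (s := Icc t₀ tf ×ˢ Metric.closedBall 0 R) hf.continuous_fderiv.continuousOn
  refine ⟨C.toNNReal, fun t ht => (convex_closedBall _ _).lipschitzOnWith_of_nnnorm_fderiv_le
    (fun y _ => (hf.contDiff t).differentiable two_ne_zero y) fun y hy => ?_⟩
  rw [← NNReal.coe_le_coe, coe_nnnorm]
  exact (hC (t, y) ⟨ht, hy⟩).trans (Real.le_coe_toNNReal C)

/-- Both trajectories stay in one ball, on which both modes are Lipschitz uniformly in time. The
Grönwall argument with right derivatives tolerates the jumps of the field at the switching times. -/
theorem IsSwitchedTrajectory.eqOn {t₀ tf τ lam : ℝ} {x₀ : Fin N → ℝ} {y z : ℝ → (Fin N → ℝ)}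
    (hf₁ : IsC2Mode f₁) (hf₂ : IsC2Mode f₂)
    (hz : IsSwitchedTrajectory f₁ f₂ t₀ tf τ lam x₀ z)
    (hy : IsSwitchedTrajectory f₁ f₂ t₀ tf τ lam x₀ y) : EqOn z y (Icc t₀ tf) := by
  obtain ⟨R₁, hR₁⟩ := isCompact_Icc.exists_bound_of_continuousOn hz.continuousOn
  obtain ⟨R₂, hR₂⟩ := isCompact_Icc.exists_bound_of_continuousOn hy.continuousOn
  obtain ⟨K₁, hK₁⟩ := hf₁.exists_lipschitzOnWith t₀ tf (max R₁ R₂)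
  obtain ⟨K₂, hK₂⟩ := hf₂.exists_lipschitzOnWith t₀ tf (max R₁ R₂)
  refine ODE_solution_unique_of_mem_Icc_right (v := switchedField f₁ f₂ τ lam) (K := max K₁ K₂)
    (s := fun _ => Metric.closedBall 0 (max R₁ R₂)) (fun t ht => ?_) hz.continuousOn hz.ode
    (fun t ht => ?_) hy.continuousOn hy.ode (fun t ht => ?_) (hz.initial.trans hy.initial.symm)
  · by_cases h : τ ≤ t ∧ t < τ + lam
    · rw [show switchedField f₁ f₂ τ lam t = f₂ t from funext fun y => if_pos h]
      exact (hK₂ t (Ico_subset_Icc_self ht)).weaken (le_max_right _ _)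
    · rw [show switchedField f₁ f₂ τ lam t = f₁ t from funext fun y => if_neg h]
      exact (hK₁ t (Ico_subset_Icc_self ht)).weaken (le_max_left _ _)
  · exact mem_closedBall_zero_iff.2 ((hR₁ t (Ico_subset_Icc_self ht)).trans (le_max_left _ _))
  · exact mem_closedBall_zero_iff.2 ((hR₂ t (Ico_subset_Icc_self ht)).trans (le_max_right _ _))

end Uniqueness

/-! ### Augmenting the state by the running cost. -/

section RunningCost

variable {V G : Type*} [NormedAddCommGroup V] [NormedSpace ℝ V] [NormedAddCommGroup G]
  [NormedSpace ℝ G]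

/-- A map `V → G` turned into an endomorphism of a larger space through `A : G → V × ℝ`. -/
noncomputable def liftCLM (A : G →L[ℝ] V × ℝ) : (V →L[ℝ] G) →L[ℝ] (V × ℝ →L[ℝ] V × ℝ) :=
  ContinuousLinearMap.compL ℝ (V × ℝ) G (V × ℝ) A ∘L
    (ContinuousLinearMap.compL ℝ (V × ℝ) V G).flip (ContinuousLinearMap.fst ℝ V ℝ)

@[simp]
theorem liftCLM_apply (A : G →L[ℝ] V × ℝ) (T : V →L[ℝ] G) (p : V × ℝ) :
    liftCLM A T p = A (T p.1) := rfl

theorem hasFDerivAt_liftCLM (A : G →L[ℝ] V × ℝ) {φ : V → V →L[ℝ] G} {φ' : V →L[ℝ] V →L[ℝ] G}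
    {p : V × ℝ} (h : HasFDerivAt φ φ' p.1) :
    HasFDerivAt (fun q : V × ℝ => liftCLM A (φ q.1))
      (liftCLM A ∘L φ' ∘L ContinuousLinearMap.fst ℝ V ℝ) p :=
  (liftCLM A).hasFDerivAt.comp p (HasFDerivAt.comp (f := Prod.fst) p h hasFDerivAt_fst)

/-- The field of the state augmented by the accumulated running cost. -/
def costField (f : ℝ → V → V) (l : V → ℝ) (t : ℝ) (p : V × ℝ) : V × ℝ := (f t p.1, l p.1)

/-- The state derivative of `costField`. -/
noncomputable def costField' (f : ℝ → V → V) (l : V → ℝ) (t : ℝ) (p : V × ℝ) : V × ℝ →L[ℝ] V × ℝ :=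
  liftCLM (ContinuousLinearMap.inl ℝ V ℝ) (fderiv ℝ (f t) p.1)
    + liftCLM (ContinuousLinearMap.inr ℝ V ℝ) (fderiv ℝ l p.1)

/-- The second state derivative of `costField`. -/
noncomputable def costField'' (f : ℝ → V → V) (l : V → ℝ) (t : ℝ) (p : V × ℝ) :
    V × ℝ →L[ℝ] V × ℝ →L[ℝ] V × ℝ :=
  liftCLM (ContinuousLinearMap.inl ℝ V ℝ) ∘L fderiv ℝ (fderiv ℝ (f t)) p.1 ∘L
      ContinuousLinearMap.fst ℝ V ℝ
    + liftCLM (ContinuousLinearMap.inr ℝ V ℝ) ∘L fderiv ℝ (fderiv ℝ l) p.1 ∘L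
      ContinuousLinearMap.fst ℝ V ℝ

theorem costField'_apply (f : ℝ → V → V) (l : V → ℝ) (t : ℝ) (p e : V × ℝ) :
    costField' f l t p e = (fderiv ℝ (f t) p.1 e.1, fderiv ℝ l p.1 e.1) := by
  simp [costField']

theorem costField''_apply (f : ℝ → V → V) (l : V → ℝ) (t : ℝ) (p e e' : V × ℝ) :
    costField'' f l t p e e' = (fderiv ℝ (fderiv ℝ (f t)) p.1 e.1 e'.1,
      fderiv ℝ (fderiv ℝ l) p.1 e.1 e'.1) := by
  simp [costField'']

theorem IsC2Mode.isC2Field_costField {N : ℕ} {f : ℝ → (Fin N → ℝ) → (Fin N → ℝ)} (hf : IsC2Mode f)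
    {l : (Fin N → ℝ) → ℝ} (hl : ContDiff ℝ 2 l) :
    IsC2Field (costField f l) (costField' f l) (costField'' f l) where
  hasFDerivAt t p := by
    have h1 := HasFDerivAt.comp (f := Prod.fst) p
      ((hf.contDiff t).differentiable two_ne_zero p.1).hasFDerivAt hasFDerivAt_fst
    have h2 := HasFDerivAt.comp (f := Prod.fst) p
      (hl.differentiable two_ne_zero p.1).hasFDerivAt hasFDerivAt_fst
    refine (h1.prodMk h2).congr_fderiv ?_
    refine ContinuousLinearMap.ext fun e => ?_
    rw [costField'_apply]
    rfl
  hasFDerivAt' t p := (hasFDerivAt_liftCLM _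
      (differentiable_fderiv_of_contDiff_two (hf.contDiff t) p.1).hasFDerivAt).add
    (hasFDerivAt_liftCLM _ (differentiable_fderiv_of_contDiff_two hl p.1).hasFDerivAt)
  continuous := (hf.continuous.comp
      (by fun_prop : Continuous fun p : ℝ × ((Fin N → ℝ) × ℝ) => (p.1, p.2.1))).prodMk
    (hl.continuous.comp (by fun_prop))
  continuous' := ((liftCLM _).continuous.comp (hf.continuous_fderiv.comp
      (by fun_prop : Continuous fun p : ℝ × ((Fin N → ℝ) × ℝ) => (p.1, p.2.1)))).add
    ((liftCLM _).continuous.comp ((hl.continuous_fderiv (by norm_num)).comp (by fun_prop)))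
  continuous'' := by
    have h1 := hf.continuous_fderiv2.comp
      (by fun_prop : Continuous fun p : ℝ × ((Fin N → ℝ) × ℝ) => (p.1, p.2.1))
    have h2 : Continuous (fderiv ℝ (fderiv ℝ l)) :=
      (hl.fderiv_right (m := 1) (by norm_num)).continuous_fderiv (by norm_num)
    exact (continuous_const.clm_comp (h1.clm_comp continuous_const)).add
      (continuous_const.clm_comp ((h2.comp (by fun_prop : Continuous
        fun p : ℝ × ((Fin N → ℝ) × ℝ) => p.2.1)).clm_comp continuous_const))

/-- The terminal cost of the augmented state. -/
def augmentedCost (m : V → ℝ) (p : V × ℝ) : ℝ := m p.1 + p.2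

theorem hasFDerivAt_augmentedCost {m : V → ℝ} (hm : Differentiable ℝ m) (p : V × ℝ) :
    HasFDerivAt (augmentedCost m) (fderiv ℝ m p.1 ∘L ContinuousLinearMap.fst ℝ V ℝ
      + ContinuousLinearMap.snd ℝ V ℝ) p :=
  (HasFDerivAt.comp (f := Prod.fst) p (hm p.1).hasFDerivAt hasFDerivAt_fst).add hasFDerivAt_snd

theorem hasFDerivAt_fderiv_augmentedCost {m : V → ℝ} (hm : Differentiable ℝ m)
    (hm' : Differentiable ℝ (fderiv ℝ m)) (p : V × ℝ) :
    HasFDerivAt (fderiv ℝ (augmentedCost m))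
      ((ContinuousLinearMap.compL ℝ (V × ℝ) V ℝ).flip (ContinuousLinearMap.fst ℝ V ℝ) ∘L
        fderiv ℝ (fderiv ℝ m) p.1 ∘L ContinuousLinearMap.fst ℝ V ℝ) p := by
  rw [show fderiv ℝ (augmentedCost m) = _ from funext fun p => (hasFDerivAt_augmentedCost hm p).fderiv]
  have h1 := HasFDerivAt.comp (f := Prod.fst) p (hm' p.1).hasFDerivAt hasFDerivAt_fst
  exact ((h1.clm_comp (hasFDerivAt_const (ContinuousLinearMap.fst ℝ V ℝ) p)).add_const _).congr_fderiv
    (by simp)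

end RunningCost

/-! ### Conserved pairings of adjoints and variations. -/

section Duality

variable {N : ℕ} {f₁ : ℝ → (Fin N → ℝ) → (Fin N → ℝ)} {l m : (Fin N → ℝ) → ℝ} {t₀ tf τ : ℝ}
  {x ρ : ℝ → (Fin N → ℝ)} {Ω : ℝ → Matrix (Fin N) (Fin N) ℝ}

theorem HasDerivWithinAt.dotProduct {u v : ℝ → (Fin N → ℝ)} {u' v' : Fin N → ℝ} {S : Set ℝ} {t : ℝ}
    (hu : HasDerivWithinAt u u' S t) (hv : HasDerivWithinAt v v' S t) :
    HasDerivWithinAt (fun s => u s ⬝ᵥ v s) (u' ⬝ᵥ v t + u t ⬝ᵥ v') S t := by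
  simp only [_root_.dotProduct, ← Finset.sum_add_distrib]
  exact HasDerivWithinAt.fun_sum fun i _ =>
    (hasDerivWithinAt_pi.1 hu i).mul (hasDerivWithinAt_pi.1 hv i)

theorem HasDerivWithinAt.matrix_mulVec {A : ℝ → Matrix (Fin N) (Fin N) ℝ}
    {A' : Matrix (Fin N) (Fin N) ℝ} {v : ℝ → (Fin N → ℝ)} {v' : Fin N → ℝ} {S : Set ℝ} {t : ℝ}
    (hA : ∀ i j, HasDerivWithinAt (fun s => A s i j) (A' i j) S t)
    (hv : HasDerivWithinAt v v' S t) :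
    HasDerivWithinAt (fun s => A s *ᵥ v s) (A' *ᵥ v t + A t *ᵥ v') S t :=
  hasDerivWithinAt_pi.2 fun i => (hasDerivWithinAt_pi.2 (hA i)).dotProduct hv

theorem eq_of_hasDerivWithinAt_zero {φ : ℝ → ℝ} {a b : ℝ} (hab : a ≤ b)
    (h : ∀ t ∈ Icc a b, HasDerivWithinAt φ 0 (Icc a b) t) : φ b = φ a :=
  constant_of_has_deriv_right_zero (fun t ht => (h t ht).continuousWithinAt)
    (fun t ht => (h t (Ico_subset_Icc_self ht)).mono_of_mem_nhdsWithin (Icc_mem_nhdsGE_of_mem ht))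
    b (right_mem_Icc.2 hab)

/-- The first adjoint is dual to the first variational equation. -/
theorem IsFirstAdjoint.duality (hτ₀ : t₀ ≤ τ) (hτf : τ ≤ tf) (hρ : IsFirstAdjoint f₁ l m t₀ tf x ρ)
    {v : ℝ → (Fin N → ℝ)} {c : ℝ → ℝ}
    (hv : ∀ t ∈ Icc τ tf, HasDerivWithinAt v (fderiv ℝ (f₁ t) (x t) (v t)) (Icc τ tf) t)
    (hc : ∀ t ∈ Icc τ tf, HasDerivWithinAt c (fderiv ℝ l (x t) (v t)) (Icc τ tf) t) :
    fderiv ℝ m (x tf) (v tf) + c tf = ρ τ ⬝ᵥ v τ + c τ := by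
  have hsub : Icc τ tf ⊆ Icc t₀ tf := Icc_subset_Icc_left hτ₀
  rw [← gradVec_dotProduct, ← hρ.terminal]
  -- The adjoint equation is what makes this pairing constant: `-Dl v` cancels `c'`, and the two
  -- Jacobian terms cancel each other.
  refine eq_of_hasDerivWithinAt_zero (φ := fun t => ρ t ⬝ᵥ v t + c t) hτf fun t ht => ?_
  refine ((((hρ.ode t (hsub ht)).mono hsub).dotProduct (hv t ht)).add (hc t ht)).congr_deriv ?_
  rw [← gradVec_dotProduct, ← jacobianMatrix_mulVec, sub_dotProduct, neg_dotProduct,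
    Matrix.mulVec_transpose, Matrix.dotProduct_mulVec]
  ring

/-- The second adjoint is dual to the second variational equation. -/
theorem IsSecondAdjoint.duality (hf₁ : IsC2Mode f₁) (hl : ContDiff ℝ 2 l)
    (hm' : Differentiable ℝ (fderiv ℝ m)) (hτ₀ : t₀ ≤ τ) (hτf : τ ≤ tf)
    (hρ : IsFirstAdjoint f₁ l m t₀ tf x ρ) (hΩ : IsSecondAdjoint f₁ l m t₀ tf x ρ Ω)
    {v w : ℝ → (Fin N → ℝ)} {c : ℝ → ℝ}
    (hv : ∀ t ∈ Icc τ tf, HasDerivWithinAt v (fderiv ℝ (f₁ t) (x t) (v t)) (Icc τ tf) t)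
    (hw : ∀ t ∈ Icc τ tf, HasDerivWithinAt w (fderiv ℝ (f₁ t) (x t) (w t)
      + fderiv ℝ (fderiv ℝ (f₁ t)) (x t) (v t) (v t)) (Icc τ tf) t)
    (hc : ∀ t ∈ Icc τ tf, HasDerivWithinAt c (fderiv ℝ l (x t) (w t)
      + fderiv ℝ (fderiv ℝ l) (x t) (v t) (v t)) (Icc τ tf) t) :
    fderiv ℝ (fderiv ℝ m) (x tf) (v tf) (v tf) + (fderiv ℝ m (x tf) (w tf) + c tf)
      = v τ ⬝ᵥ (Ω τ *ᵥ v τ) + (ρ τ ⬝ᵥ w τ + c τ) := by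
  have hsub : Icc τ tf ⊆ Icc t₀ tf := Icc_subset_Icc_left hτ₀
  -- A matrix and its transpose have the same quadratic form, so symmetry of the Hessian is not
  -- invoked.
  have hterm : fderiv ℝ (fderiv ℝ m) (x tf) (v tf) (v tf) = v tf ⬝ᵥ (Ω tf *ᵥ v tf) := by
    rw [hΩ.terminal, Matrix.mulVec_transpose, dotProduct_comm, ← Matrix.dotProduct_mulVec,
      dotProduct_hessianMatrix_mulVec (hm' _)]
  rw [hterm, ← gradVec_dotProduct, ← hρ.terminal]
  refine eq_of_hasDerivWithinAt_zero
    (φ := fun t => v t ⬝ᵥ (Ω t *ᵥ v t) + (ρ t ⬝ᵥ w t + c t)) hτf fun t ht => ?_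
  have h1 := (hv t ht).dotProduct (HasDerivWithinAt.matrix_mulVec
    (fun i j => (hΩ.ode t (hsub ht) i j).mono hsub) (hv t ht))
  have h2 := (((hρ.ode t (hsub ht)).mono hsub).dotProduct (hw t ht)).add (hc t ht)
  refine (h1.add h2).congr_deriv ?_
  -- The sum in the equation of `Ω` is there to cancel the forcing `D² f₁ (v, v)` of `w`, weighted
  -- by `ρ`.
  have hsum : v t ⬝ᵥ ((∑ k : Fin N, ρ t k • hessianMatrix (fun y => f₁ t y k) (x t)) *ᵥ v t)
      = ρ t ⬝ᵥ fderiv ℝ (fderiv ℝ (f₁ t)) (x t) (v t) (v t) := by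
    rw [Matrix.sum_mulVec, dotProduct_sum]
    refine Finset.sum_congr rfl fun k _ => ?_
    rw [Matrix.smul_mulVec, dotProduct_smul, dotProduct_hessianMatrix_mulVec
      (differentiable_fderiv_of_contDiff_two (contDiff_pi.1 (hf₁.contDiff t) k) _),
      fderiv_fderiv_component (hf₁.contDiff t), smul_eq_mul]
  set J := jacobianMatrix (f₁ t) (x t) with hJ
  have hJv : ∀ e, fderiv ℝ (f₁ t) (x t) e = J *ᵥ e := fun e => (jacobianMatrix_mulVec _ _ e).symm
  have h3 : v t ⬝ᵥ ((-(Jᵀ * Ω t) - Ω t * J - hessianMatrix l (x t)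
      - ∑ k : Fin N, ρ t k • hessianMatrix (fun y => f₁ t y k) (x t)) *ᵥ v t)
      = -((J *ᵥ v t) ⬝ᵥ (Ω t *ᵥ v t)) - v t ⬝ᵥ (Ω t *ᵥ (J *ᵥ v t))
        - fderiv ℝ (fderiv ℝ l) (x t) (v t) (v t)
        - ρ t ⬝ᵥ fderiv ℝ (fderiv ℝ (f₁ t)) (x t) (v t) (v t) := by
    rw [Matrix.sub_mulVec, Matrix.sub_mulVec, Matrix.sub_mulVec, Matrix.neg_mulVec, dotProduct_sub,
      dotProduct_sub, dotProduct_sub, dotProduct_neg, hsum, dotProduct_hessianMatrix_mulVec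
      (differentiable_fderiv_of_contDiff_two hl _), ← Matrix.mulVec_mulVec, ← Matrix.mulVec_mulVec,
      Matrix.dotProduct_mulVec (v t) Jᵀ, Matrix.vecMul_transpose]
  rw [dotProduct_add, h3, hJv, hJv, dotProduct_add, sub_dotProduct, neg_dotProduct,
    Matrix.mulVec_transpose, Matrix.dotProduct_mulVec (ρ t) J, gradVec_dotProduct]
  ring

end Duality

/-! ### Gluing trajectories at the insertion time. -/

section SwitchedTrajectory

variable {N : ℕ} {f₁ f₂ : ℝ → (Fin N → ℝ) → (Fin N → ℝ)} {t₀ tf τ lam : ℝ} {x₀ : Fin N → ℝ}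
  {x y : ℝ → (Fin N → ℝ)}

theorem switchedField_of_mem {t : ℝ} (h₁ : τ ≤ t) (h₂ : t < τ + lam) :
    switchedField f₁ f₂ τ lam t = f₂ t := funext fun _ => if_pos ⟨h₁, h₂⟩

theorem switchedField_of_lt {t : ℝ} (h : t < τ) : switchedField f₁ f₂ τ lam t = f₁ t :=
  funext fun _ => if_neg fun h' => h'.1.not_gt h

theorem switchedField_of_le {t : ℝ} (h : τ + lam ≤ t) : switchedField f₁ f₂ τ lam t = f₁ t :=
  funext fun _ => if_neg fun h' => h.not_gt h'.2

theorem IsSwitchedTrajectory.hasDerivWithinAt_default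
    (hx : IsSwitchedTrajectory f₁ f₂ t₀ tf τ 0 x₀ x) {t : ℝ} (ht : t ∈ Ico t₀ tf) :
    HasDerivWithinAt x (f₁ t (x t)) (Ici t) t := by
  have h := hx.ode t ht
  rcases lt_or_ge t τ with h' | h'
  · rwa [switchedField_of_lt h'] at h
  · rwa [switchedField_of_le (by simpa using h')] at h

/-- The default trajectory up to `τ`, continued by a solution after `τ`, is a switched trajectory. -/
theorem IsSwitchedTrajectory.concat (hx : IsSwitchedTrajectory f₁ f₂ t₀ tf τ 0 x₀ x)
    (hτ₀ : t₀ ≤ τ) (hτf : τ ≤ tf) (hyτ : y τ = x τ) (hy : ContinuousOn y (Icc τ tf))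
    (hy' : ∀ t ∈ Ico τ tf, HasDerivWithinAt y (switchedField f₁ f₂ τ lam t (y t)) (Ici t) t) :
    IsSwitchedTrajectory f₁ f₂ t₀ tf τ lam x₀ (fun t => if t < τ then x t else y t) where
  continuousOn := by
    have h₁ : ContinuousOn (fun t => if t < τ then x t else y t) (Icc t₀ τ) := by
      refine (hx.continuousOn.mono (Icc_subset_Icc_right hτf)).congr fun t ht => ?_
      rcases ht.2.lt_or_eq with h | h
      · exact if_pos h
      · simp [h, hyτ]
    have h₂ : ContinuousOn (fun t => if t < τ then x t else y t) (Icc τ tf) :=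
      hy.congr fun t ht => if_neg ht.1.not_gt
    rw [← Icc_union_Icc_eq_Icc hτ₀ hτf]
    exact h₁.union_of_isClosed h₂ isClosed_Icc isClosed_Icc
  initial := by
    rcases hτ₀.lt_or_eq with h | h
    · rw [if_pos h, hx.initial]
    · rw [if_neg h.not_lt, h, hyτ, ← h, hx.initial]
  ode t ht := by
    rcases lt_or_ge t τ with h | h
    · rw [switchedField_of_lt h, if_pos h]
      refine (hx.hasDerivWithinAt_default ht).congr_of_eventuallyEq ?_ (if_pos h)
      filter_upwards [mem_nhdsWithin_of_mem_nhds (Iio_mem_nhds h)] with s hs using if_pos hs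
    · rw [if_neg h.not_gt]
      exact (hy' t ⟨h, ht.2⟩).congr (fun s hs => if_neg (h.trans hs).not_gt) (if_neg h.not_gt)

end SwitchedTrajectory

/-! ### The main theorem. -/

theorem mainTheorem4 {N : ℕ} (f₁ f₂ : ℝ → (Fin N → ℝ) → (Fin N → ℝ))
    (hf₁ : IsC2Mode f₁) (hf₂ : IsC2Mode f₂)
    (l m : (Fin N → ℝ) → ℝ) (hl : ContDiff ℝ 2 l)
    (hm : Differentiable ℝ m) (hm' : Differentiable ℝ (fderiv ℝ m))
    (t₀ tf τ : ℝ) (hτ₀ : t₀ ≤ τ) (hτf : τ < tf)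
    -- `d` is the partial time derivative of `f₂ - f₁` on `[τ, τ + r]` (zero for autonomous modes)
    (r : ℝ) (hr : 0 < r) (d : ℝ → (Fin N → ℝ) → (Fin N → ℝ))
    (hd : ∀ t ∈ Icc τ (τ + r), ∀ y,
      HasDerivWithinAt (fun s => f₂ s y - f₁ s y) (d t y) (Icc τ (τ + r)) t)
    (hdc : ContinuousOn (fun p : ℝ × (Fin N → ℝ) => d p.1 p.2) (Icc τ (τ + r) ×ˢ univ))
    -- `x` is the default trajectory
    (x₀ : Fin N → ℝ) (x : ℝ → (Fin N → ℝ))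
    (hx : IsSwitchedTrajectory f₁ f₂ t₀ tf τ 0 x₀ x) :
    -- the adjoints exist
    (∃ ρ Ω, IsFirstAdjoint f₁ l m t₀ tf x ρ ∧ IsSecondAdjoint f₁ l m t₀ tf x ρ Ω) ∧
    ∃ ε : ℝ, 0 < ε ∧ τ + ε ≤ tf ∧
      -- the switched system has exactly one trajectory for every small duration
      (∀ lam ∈ Icc 0 ε, ∃ y, IsSwitchedTrajectory f₁ f₂ t₀ tf τ lam x₀ y ∧
        ∀ z, IsSwitchedTrajectory f₁ f₂ t₀ tf τ lam x₀ z → EqOn z y (Icc t₀ tf)) ∧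
      -- the cost as a function of the duration, its first derivative `J₁` and its second one `J₂`
      ∀ X : ℝ → ℝ → (Fin N → ℝ),
        (∀ lam ∈ Icc 0 ε, IsSwitchedTrajectory f₁ f₂ t₀ tf τ lam x₀ (X lam)) →
        ∃ J₁ J₂ : ℝ → ℝ,
          (∀ lam ∈ Icc 0 ε,
            HasDerivWithinAt (fun s => trajectoryCost l m t₀ tf (X s)) (J₁ lam) (Icc 0 ε) lam ∧
            HasDerivWithinAt J₁ (J₂ lam) (Icc 0 ε) lam) ∧
          (ContDiff ℝ 2 m → Tendsto J₂ (𝓝[>] 0) (𝓝 (J₂ 0))) ∧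
          ∀ ρ Ω, IsFirstAdjoint f₁ l m t₀ tf x ρ → IsSecondAdjoint f₁ l m t₀ tf x ρ Ω →
            J₂ 0 = modeInsertionHessian f₁ f₂ l τ x ρ Ω + ρ τ ⬝ᵥ d τ (x τ) ∧
            (d τ (x τ) = 0 → J₂ 0 = modeInsertionHessian f₁ f₂ l τ x ρ Ω) := by
  have hsub : Icc τ tf ⊆ Icc t₀ tf := Icc_subset_Icc_left hτ₀
  have hxc : ContinuousOn x (Icc τ tf) := hx.continuousOn.mono hsub
  have hlx : ContinuousOn (fun t => l (x t)) (Icc t₀ tf) :=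
    hl.continuous.comp_continuousOn hx.continuousOn
  have hL : ∀ t ∈ Icc τ tf, HasDerivWithinAt (fun t => ∫ s in τ..t, l (x s)) (l (x t)) (Icc τ tf) t :=
    fun t ht => hasDerivWithinAt_integral_Icc (hlx.mono hsub) ht
  -- The augmentation starts at `τ`, since the trajectories agree before. Both augmented fields have
  -- the same last component `l`, so the time derivative of their difference is `(d, 0)`.
  obtain ⟨ε, hε, hεf, Z, J₁, J₂, hZ, hJ, hJc, P, Q, hJ0, hP, v, w, hva, hwa, hv, hw, hQ⟩ :=
    exists_insertion_terminal_cost (hf₁.isC2Field_costField hl) (hf₂.isC2Field_costField hl) hτf hr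
      (d := fun t p => (d t p.1, 0)) (fun t ht p => by
        simpa [costField] using! (hd t ht p.1).prodMk (hasDerivWithinAt_const t _ (0 : ℝ)))
      ((hdc.comp (by fun_prop : Continuous fun p : ℝ × ((Fin N → ℝ) × ℝ) => (p.1, p.2.1)).continuousOn
        (fun p hp => ⟨hp.1, mem_univ _⟩)).prodMk continuousOn_const)
      (M := augmentedCost m) (fun p => (hasFDerivAt_augmentedCost hm p).differentiableAt)
      (fun p => (hasFDerivAt_fderiv_augmentedCost hm hm' p).differentiableAt)
      (x := fun t => (x t, ∫ s in τ..t, l (x s)))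
      (hxc.prodMk fun t ht => (hL t ht).continuousWithinAt)
      (fun t ht => (hx.hasDerivWithinAt_default ⟨hτ₀.trans ht.1, ht.2⟩).prodMk
        ((hL t (Ico_subset_Icc_self ht)).mono_of_mem_nhdsWithin (Icc_mem_nhdsGE_of_mem ht)))
  have hy : ∀ lam ∈ Icc 0 ε, IsSwitchedTrajectory f₁ f₂ t₀ tf τ lam x₀
      (fun t => if t < τ then x t else (Z lam t).1) := by
    intro lam hlam
    obtain ⟨h0, hc, h2, h1⟩ := hZ lam hlam
    refine hx.concat hτ₀ hτf.le (by rw [h0]) hc.fst fun t ht => ?_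
    rcases lt_or_ge t (τ + lam) with h | h
    · rw [switchedField_of_mem ht.1 h]
      exact (h2 t ⟨ht.1, h⟩).fst
    · rw [switchedField_of_le h]
      exact (h1 t ⟨h, ht.2⟩).fst
  -- By uniqueness the cost does not depend on the choice of trajectory and can be read off `Z`.
  have hcost : ∀ lam ∈ Icc 0 ε, ∀ z, IsSwitchedTrajectory f₁ f₂ t₀ tf τ lam x₀ z →
      trajectoryCost l m t₀ tf z = (∫ t in t₀..τ, l (x t)) + augmentedCost m (Z lam tf) := by
    intro lam hlam z hz
    have heq := hz.eqOn hf₁ hf₂ (hy lam hlam)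
    obtain ⟨h0, hc, h2, h1⟩ := hZ lam hlam
    have hzc : ContinuousOn (fun t => l (z t)) (Icc t₀ tf) :=
      hl.continuous.comp_continuousOn hz.continuousOn
    have hzZ : ∀ t ∈ Icc τ tf, z t = (Z lam t).1 := fun t ht => by
      rw [heq (hsub ht)]
      exact if_neg ht.1.not_gt
    have hxz : ∀ t ∈ Icc t₀ τ, z t = x t := fun t ht => by
      rw [heq ⟨ht.1, ht.2.trans hτf.le⟩]
      rcases ht.2.lt_or_eq with h | h
      · exact if_pos h
      · simp [h, h0]
    have hint2 : ∫ t in τ..tf, l (z t) = (Z lam tf).2 := by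
      have := intervalIntegral.integral_eq_sub_of_hasDeriv_right_of_le (f := fun t => (Z lam t).2)
        (f' := fun t => l (z t)) hτf.le hc.snd (fun t ht => by
          rw [hzZ t (Ioo_subset_Icc_self ht)]
          rcases lt_or_ge t (τ + lam) with h | h
          · exact ((h2 t ⟨ht.1.le, h⟩).mono Ioi_subset_Ici_self).snd
          · exact ((h1 t ⟨h, ht.2⟩).mono Ioi_subset_Ici_self).snd)
        ((hzc.mono hsub).intervalIntegrable_of_Icc hτf.le)
      rw [this, h0]
      simp
    have hint1 : ∫ t in t₀..τ, l (z t) = ∫ t in t₀..τ, l (x t) :=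
      intervalIntegral.integral_congr fun t ht => by
        rw [uIcc_of_le hτ₀] at ht
        simp only [hxz t ht]
    rw [trajectoryCost, ← intervalIntegral.integral_add_adjacent_intervals
      ((hzc.mono (Icc_subset_Icc_right hτf.le)).intervalIntegrable_of_Icc hτ₀)
      ((hzc.mono hsub).intervalIntegrable_of_Icc hτf.le), hint1, hint2,
      hzZ tf (right_mem_Icc.2 hτf.le), augmentedCost]
    ring
  refine ⟨?_, ε, hε, hεf, fun lam hlam => ⟨_, hy lam hlam, fun z hz => hz.eqOn hf₁ hf₂ (hy lam hlam)⟩,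
    fun X hX => ⟨J₁, J₂, fun lam hlam => ⟨?_, (hJ lam hlam).2⟩, fun hm2 => ?_, fun ρ Ω hρ hΩ => ?_⟩⟩
  · obtain ⟨ρ, hρ⟩ := exists_isFirstAdjoint (m := m) hf₁ hl (hτ₀.trans hτf.le) hx.continuousOn
    obtain ⟨Ω, hΩ⟩ := exists_isSecondAdjoint (m := m) hf₁ hl (hτ₀.trans hτf.le) hx.continuousOn
      (fun t ht => (hρ.ode t ht).continuousWithinAt)
    exact ⟨ρ, Ω, hρ, hΩ⟩
  · exact ((hJ lam hlam).1.const_add _).congr (fun s hs => hcost s hs _ (hX s hs))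
      (hcost lam hlam _ (hX lam hlam))
  · have hM2 : ContDiff ℝ 2 (augmentedCost m) := (hm2.comp contDiff_fst).add contDiff_snd
    exact (hJc hM2).mono_of_mem_nhdsWithin (mem_of_superset (Ioc_mem_nhdsGT hε) Ioc_subset_Icc_self)
  · suffices h : J₂ 0 = modeInsertionHessian f₁ f₂ l τ x ρ Ω + ρ τ ⬝ᵥ d τ (x τ) from
      ⟨h, fun h0 => by rw [h, h0, dotProduct_zero, add_zero]⟩
    have hPe : ∀ e, P e = ρ τ ⬝ᵥ e.1 + e.2 := by
      intro e
      obtain ⟨u, hu0, hu, hPe⟩ := hP e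
      simp only [costField'_apply] at hu
      rw [hPe, (hasFDerivAt_augmentedCost hm _).fderiv, ← hu0]
      exact hρ.duality hτ₀ hτf.le (fun t ht => (hu t ht).fst) (fun t ht => (hu t ht).snd)
    -- The second variation and the cost component of the first both vanish at `τ`, so only the
    -- quadratic form of `Ω` survives.
    have hQe : Q = (f₂ τ (x τ) - f₁ τ (x τ)) ⬝ᵥ (Ω τ *ᵥ (f₂ τ (x τ) - f₁ τ (x τ))) := by
      simp only [costField'_apply, costField''_apply] at hv hw
      have := hΩ.duality hf₁ hl hm' hτ₀ hτf.le hρ (fun t ht => (hv t ht).fst)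
        (fun t ht => (hw t ht).fst) (fun t ht => (hw t ht).snd)
      rw [hQ, (hasFDerivAt_augmentedCost hm _).fderiv,
        (hasFDerivAt_fderiv_augmentedCost hm hm' _).fderiv]
      refine this.trans ?_
      rw [hva, hwa]
      simp [costField]
    -- The cost component of `F₂' F₂ + F₁' F₁ - 2 F₁' F₂` is `Dl f₂ + Dl f₁ - 2 Dl f₂`, which is the
    -- source of the term `-Dl (f₂ - f₁)`.
    rw [hJ0, hQe, hPe, modeInsertionHessian]
    simp only [costField'_apply, costField, jacobianMatrix_mulVec, gradVec_dotProduct, Prod.fst_add,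
      Prod.fst_sub, Prod.snd_add, Prod.snd_sub, Prod.smul_mk, smul_eq_mul, dotProduct_add,
      dotProduct_sub]
    ring
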